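/- Theorem 2. Let $S^3\subset\mathbb R^4$ be the unit sphere with toroidal coordinates $x=\cos\chi\cos\theta,\ y=\cos\chi\sin\theta,\ z=\sin\chi\cos\varphi,\ w=\sin\chi\sin\varphi$ ($0\le\chi\le\pi/2$, $\theta,\varphi\in\mathbb R$), and with its round metric and volume $dV$. Let $p\ge 1$ and $q$ be integers, and let $L(p,q)$ be the quotient of $S^3$ by the cyclic group generated by $(\chi,\theta,\varphi)\mapsto(\chi,\theta+2\pi/p,\varphi+2\pi q/p)$, with the metric induced from $S^3$ (a lens space if $\gcd(p,q)=1$; otherwise, an orbifold). A function $f$ on $L(p,q)$ is identified with its lift, an invariant function on $S^3$; $f$ is smooth if its lift is, its Laplacian is the function whose lift is the Laplacian of the lift of $f$, and $\langle f,g\rangle=\int_{S^3} fg\,dV$, the integral being that of the lifts. For integers $k\ge 0$, $\ell$, $m$ with $|\ell|+|m|\le k$ and $\ell+m\equiv k\pmod 2$ put $d=(k-|\ell|-|m|)/2$ and $$\Psi_{k,\ell,m}(\chi,\theta,\varphi)=\frac{\cos^{|\ell|}\chi\,\sin^{|m|}\chi\;P_d^{(|m|,|\ell|)}(\cos 2\chi)\;\Theta_\ell(\theta)\,\Theta_m(\varphi)}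 {\sqrt{2^{\hat\ell+\hat m}}\;\pi\;\sqrt{\dfrac{(|\ell|+d)!\,(|m|+d)!}{2(k+1)\,d!\,(|\ell|+|m|+d)!}}},$$ where $\Theta_n(t)=\cos|n|t$ for $n\ge0$ and $\Theta_n(t)=\sin|n|t$ for $n<0$, $\hat n$ is $1$ if $n=0$ and $0$ otherwise, and $P_d^{(a,b)}(u)=2^{-d}\sum_{i=0}^d\binom{a+d}{i}\binom{b+d}{d-i}(u+1)^i(u-1)^{d-i}$ is the Jacobi polynomial. Then every eigenvalue of the Laplacian on smooth real functions on $L(p,q)$ has the form $-k(k+2)$ with an integer $k\ge0$, and for every integer $k\ge0$ the space of smooth real functions $f$ on $L(p,q)$ with $\nabla^2f=-k(k+2)f$ has a basis, orthonormal for $\langle\cdot,\cdot\rangle$, whose lifts to $S^3$ are exactly the following functions, where all index pairs $(\ell,m)$ are subject to $|\ell|+|m|\le k$ and $\ell+m\equiv k\pmod 2$: * $\Psi_{k,0,0}$ (if $k$ is even); * $\Psi_{k,\ell,0}$ and $\Psi_{k,-\ell,0}$ for $\ell>0$ with $\ell\equiv0\pmod p$; * $\Psi_{k,0,m}$ and $\Psi_{k,0,-m}$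 for $m>0$ with $qm\equiv0\pmod p$; * $\sqrt{\tfrac12}(\Psi_{k,\ell,m}+\Psi_{k,-\ell,-m})$ and $\sqrt{\tfrac12}(\Psi_{k,-\ell,m}-\Psi_{k,\ell,-m})$ for $\ell,m>0$ with $\ell\equiv qm\pmod p$; * $\sqrt{\tfrac12}(\Psi_{k,\ell,m}-\Psi_{k,-\ell,-m})$ and $\sqrt{\tfrac12}(\Psi_{k,-\ell,m}+\Psi_{k,\ell,-m})$ for $\ell,m>0$ with $\ell\equiv-qm\pmod p$. -/

import Mathlib

open scoped Manifold ContDiff Laplacian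

noncomputable section

namespace LensSpace

/-! ### The 3-sphere, its volume and its Laplacian -/

/-- Euclidean 4-space with coordinates `(x, y, z, w)`. -/
abbrev E4 : Type := EuclideanSpace ℝ (Fin 4)

/-- The unit 3-sphere in `E4`. -/
abbrev S3 : Type := Metric.sphere (0 : E4) 1

instance : Fact (Module.finrank ℝ E4 = 3 + 1) := ⟨by simp⟩

/-- The Riemannian volume measure of the round 3-sphere (total mass `2 π ^ 2`). -/
def vol3 : MeasureTheory.Measure S3 := (MeasureTheory.volume : MeasureTheory.Measure E4).toSphere

/-- Smooth real functions on the 3-sphere. -/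
def IsSmooth3 (F : S3 → ℝ) : Prop := ContMDiff (𝓡 3) 𝓘(ℝ, ℝ) ∞ F

/-- Radial projection of a nonzero vector to the sphere. -/
def radialProj (y : E4) (h : y ≠ 0) : S3 :=
  ⟨‖y‖⁻¹ • y, by simp [norm_smul, h]⟩

/-- The extension of a function on the sphere that is constant along rays. -/
def radialExt (F : S3 → ℝ) (y : E4) : ℝ :=
  open Classical in if h : y ≠ 0 then F (radialProj y h) else 0

/-- The Laplace-Beltrami operator of the round 3-sphere: the Euclidean Laplacian of the extension
that is constant along rays, restricted to the sphere. -/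
def sphereLaplacian (F : S3 → ℝ) (x : S3) : ℝ := Δ (radialExt F) (x : E4)

theorem radialExt_contDiffAt {F : S3 → ℝ} (hF : IsSmooth3 F) (x : S3) :
    ContDiffAt ℝ ∞ (radialExt F) (x : E4) := by
  let U : TopologicalSpace.Opens E4 := ⟨{0}ᶜ, isOpen_compl_singleton⟩
  have hx : (x : E4) ≠ 0 := ne_zero_of_mem_unit_sphere x
  let n : U → E4 := fun y => ‖(y : E4)‖⁻¹ • (y : E4)
  have hn : ContMDiff 𝓘(ℝ, E4) 𝓘(ℝ, E4) ∞ n := by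
    intro y
    have hy : (y : E4) ≠ 0 := y.2
    have h : ContDiffAt ℝ ∞ (fun z : E4 => ‖z‖⁻¹ • z) (y : E4) :=
      ((contDiffAt_norm ℝ hy).inv (norm_ne_zero_iff.2 hy)).smul contDiffAt_id
    exact contMDiffAt_subtype_iff.2 h.contMDiffAt
  have hn' : ∀ y, n y ∈ Metric.sphere (0 : E4) 1 := fun y => (radialProj y.1 y.2).2
  have hc : ContMDiff 𝓘(ℝ, E4) 𝓘(ℝ, ℝ) ∞
      (fun y : U => F (Set.codRestrict n (Metric.sphere (0 : E4) 1) hn' y)) :=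
    ContMDiff.comp (I' := 𝓡 3) hF (hn.codRestrict_sphere (n := 3) hn')
  have he : (fun y : U => F (Set.codRestrict n (Metric.sphere (0 : E4) 1) hn' y)) =
      fun y : U => radialExt F y := by
    funext y
    have hy : (y : E4) ≠ 0 := y.2
    simp only [radialExt, dif_pos hy]
    rfl
  rw [he] at hc
  exact (contMDiffAt_subtype_iff.1 (hc ⟨x, hx⟩)).contDiffAt

theorem laplacian_comp_isometry (L : E4 ≃ₗᵢ[ℝ] E4) (f : E4 → ℝ) (x : E4) :
    Δ (f ∘ L) x = Δ f (L x) := by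
  rw [InnerProductSpace.laplacian_eq_iteratedFDeriv_orthonormalBasis (f ∘ L)
    (EuclideanSpace.basisFun (Fin 4) ℝ),
    InnerProductSpace.laplacian_eq_iteratedFDeriv_orthonormalBasis f
    ((EuclideanSpace.basisFun (Fin 4) ℝ).map L)]
  refine Finset.sum_congr rfl fun i _ => ?_
  have := L.toContinuousLinearEquiv.iteratedFDerivWithin_comp_right f (s := Set.univ) (x := x)
    uniqueDiffOn_univ (Set.mem_univ _) 2
  rw [Set.preimage_univ, iteratedFDerivWithin_univ, iteratedFDerivWithin_univ] at this
  have h2 : (f ∘ L) = f ∘ L.toContinuousLinearEquiv := rfl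
  rw [h2, this]
  simp only [ContinuousMultilinearMap.compContinuousLinearMap_apply, OrthonormalBasis.map_apply]
  congr 1
  funext j
  fin_cases j <;> rfl

/-! ### Lens spaces -/

/-- The rotation of `E4` by the angle `a` in the `(x, y)`-plane and by `b` in the
`(z, w)`-plane. -/
def rot (a b : ℝ) : E4 ≃ₗᵢ[ℝ] E4 where
  toFun v := !₂[Real.cos a * v 0 - Real.sin a * v 1, Real.sin a * v 0 + Real.cos a * v 1,
    Real.cos b * v 2 - Real.sin b * v 3, Real.sin b * v 2 + Real.cos b * v 3]
  invFun v := !₂[Real.cos a * v 0 + Real.sin a * v 1, -Real.sin a * v 0 + Real.cos a * v 1,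
    Real.cos b * v 2 + Real.sin b * v 3, -Real.sin b * v 2 + Real.cos b * v 3]
  map_add' u v := by ext i; fin_cases i <;> simp <;> ring
  map_smul' c v := by ext i; fin_cases i <;> simp <;> ring
  left_inv v := by
    ext i
    fin_cases i <;> simp
    · linear_combination v 0 * Real.sin_sq_add_cos_sq a
    · linear_combination v 1 * Real.sin_sq_add_cos_sq a
    · linear_combination v 2 * Real.sin_sq_add_cos_sq b
    · linear_combination v 3 * Real.sin_sq_add_cos_sq b
  right_inv v := by
    ext i
    fin_cases i <;> simp
    · linear_combination v 0 * Real.sin_sq_add_cos_sq a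
    · linear_combination v 1 * Real.sin_sq_add_cos_sq a
    · linear_combination v 2 * Real.sin_sq_add_cos_sq b
    · linear_combination v 3 * Real.sin_sq_add_cos_sq b
  norm_map' v := by
    simp only [EuclideanSpace.norm_eq]
    congr 1
    simp [Fin.sum_univ_four]
    linear_combination (v 0 ^ 2 + v 1 ^ 2) * Real.sin_sq_add_cos_sq a +
      (v 2 ^ 2 + v 3 ^ 2) * Real.sin_sq_add_cos_sq b

/-- The permutation of the sphere induced by a linear isometry. -/
def spherePerm (L : E4 ≃ₗᵢ[ℝ] E4) : Equiv.Perm S3 where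
  toFun x := ⟨L x, by simp⟩
  invFun x := ⟨L.symm x, by simp⟩
  left_inv x := by simp
  right_inv x := by simp

/-- The isometry `(χ, θ, φ) ↦ (χ, θ + 2π/p, φ + 2πq/p)` of the 3-sphere. -/
def gen (p : ℕ) (q : ℤ) : Equiv.Perm S3 :=
  spherePerm (rot (2 * Real.pi / p) (2 * Real.pi * q / p))

/-- The lens space `L(p, q)`: the orbit space of the cyclic group generated by `gen p q`. -/
abbrev Lens (p : ℕ) (q : ℤ) : Type :=
  MulAction.orbitRel.Quotient (Subgroup.zpowers (gen p q)) S3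

/-- The projection of the 3-sphere onto the lens space. -/
def proj (p : ℕ) (q : ℤ) (x : S3) : Lens p q := Quotient.mk _ x

/-- The lift to the 3-sphere of a function on the lens space. -/
def lift {p : ℕ} {q : ℤ} (f : Lens p q → ℝ) (x : S3) : ℝ := f (proj p q x)

/-- Smooth functions on the lens space: the projection is a local diffeomorphism if `p` and `q` are
coprime, and if they are not, these are the smooth functions on the quotient orbifold. -/
def IsSmooth {p : ℕ} {q : ℤ} (f : Lens p q → ℝ) : Prop := IsSmooth3 (lift f)

theorem sphereLaplacian_isometry (L : E4 ≃ₗᵢ[ℝ] E4) (F : S3 → ℝ)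
    (hF : ∀ x, F (spherePerm L x) = F x) (x : S3) :
    sphereLaplacian F (spherePerm L x) = sphereLaplacian F x := by
  have h : radialExt F ∘ L = radialExt F := by
    funext y
    by_cases hy : y = 0
    · simp [radialExt, hy]
    · have hy' : L y ≠ 0 := by simpa using hy
      rw [Function.comp_apply, radialExt, radialExt, dif_pos hy, dif_pos hy',
        ← hF (radialProj y hy)]
      congr 1
      ext1
      simp [radialProj, spherePerm]
  have := laplacian_comp_isometry L (radialExt F) x
  rw [h] at this
  exact this.symm

theorem lift_gen {p : ℕ} {q : ℤ} (f : Lens p q → ℝ) (x : S3) :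
    lift f (gen p q x) = lift f x := by
  unfold lift proj
  congr 1
  exact Quotient.sound ⟨⟨gen p q, Subgroup.mem_zpowers _⟩, rfl⟩

theorem sphereLaplacian_lift_eq {p : ℕ} {q : ℤ} (f : Lens p q → ℝ) (x y : S3)
    (h : (MulAction.orbitRel (Subgroup.zpowers (gen p q)) S3).r x y) :
    sphereLaplacian (lift f) x = sphereLaplacian (lift f) y := by
  have key : ∀ z, sphereLaplacian (lift f) (gen p q z) = sphereLaplacian (lift f) z :=
    fun z => sphereLaplacian_isometry _ _ (fun w => lift_gen f w) z
  obtain ⟨⟨s, n, rfl⟩, rfl⟩ := h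
  change sphereLaplacian (lift f) ((gen p q ^ n) y) = _
  induction n with
  | zero => simp
  | succ n ih =>
    rw [add_comm, zpow_add, zpow_one]
    exact (key _).trans ih
  | pred n ih =>
    refine Eq.trans ?_ ih
    rw [← key, ← Equiv.Perm.mul_apply, ← zpow_one_add]
    congr 3
    ring

/-- The Laplace-Beltrami operator of `L(p, q)` for the metric that makes the projection from the
round 3-sphere a local isometry: near `proj p q x` a function on `L(p, q)` is identified with its
lift near `x`. -/
def lensLaplacian {p : ℕ} {q : ℤ} (f : Lens p q → ℝ) : Lens p q → ℝ :=
  Quotient.lift (sphereLaplacian (lift f)) (sphereLaplacian_lift_eq f)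

/-- The space of smooth real functions `f` on `L(p, q)` with `Δ f = c f`. -/
def eigenspace (p : ℕ) (q : ℤ) (c : ℝ) : Submodule ℝ (Lens p q → ℝ) where
  carrier := {f | IsSmooth f ∧ ∀ x, lensLaplacian f x = c * f x}
  zero_mem' := by
    refine ⟨contMDiff_const, ?_⟩
    rintro ⟨x⟩
    have : radialExt (lift (0 : Lens p q → ℝ)) = fun _ => 0 := by
      funext y
      simp [radialExt, lift]
    change Δ (radialExt (lift (0 : Lens p q → ℝ))) (x : E4) = c * 0
    rw [this, InnerProductSpace.laplacian_const]
    simp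
  add_mem' := by
    rintro f g ⟨hf, hf'⟩ ⟨hg, hg'⟩
    refine ⟨ContMDiff.add hf hg, ?_⟩
    rintro ⟨x⟩
    have : radialExt (lift (f + g)) = radialExt (lift f) + radialExt (lift g) := by
      funext y
      by_cases hy : y = 0 <;> simp [radialExt, lift, hy]
    have h1 : Δ (radialExt (lift f)) (x : E4) = c * f (proj p q x) := hf' (proj p q x)
    have h2 : Δ (radialExt (lift g)) (x : E4) = c * g (proj p q x) := hg' (proj p q x)
    change Δ (radialExt (lift (f + g))) (x : E4) = c * (f (proj p q x) + g (proj p q x))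
    rw [this, ContDiffAt.laplacian_add ((radialExt_contDiffAt hf x).of_le (by norm_cast))
      ((radialExt_contDiffAt hg x).of_le (by norm_cast)), h1, h2]
    ring
  smul_mem' := by
    rintro a f ⟨hf, hf'⟩
    refine ⟨(contDiff_const_smul a).contMDiff.comp hf, ?_⟩
    rintro ⟨x⟩
    have : radialExt (lift (a • f)) = a • radialExt (lift f) := by
      funext y
      by_cases hy : y = 0 <;> simp [radialExt, lift, hy]
    have h1 : Δ (radialExt (lift f)) (x : E4) = c * f (proj p q x) := hf' (proj p q x)
    change Δ (radialExt (lift (a • f))) (x : E4) = c * (a * f (proj p q x))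
    rw [this, InnerProductSpace.laplacian_smul a
      ((radialExt_contDiffAt hf x).of_le (by norm_cast)), h1]
    simp only [smul_eq_mul]
    ring

/-- The inner product of the lifts: the integral over the 3-sphere of their product. -/
def lensInner {p : ℕ} {q : ℤ} (f g : Lens p q → ℝ) : ℝ :=
  ∫ x, lift f x * lift g x ∂vol3

/-! ### Toroidal coordinates and the eigenmodes of the 3-sphere -/

/-- The point of the 3-sphere with toroidal coordinates `(χ, θ, φ)`. -/
def toroidal (χ θ φ : ℝ) : S3 :=
  ⟨!₂[Real.cos χ * Real.cos θ, Real.cos χ * Real.sin θ,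
    Real.sin χ * Real.cos φ, Real.sin χ * Real.sin φ], by
    have h : ‖(!₂[Real.cos χ * Real.cos θ, Real.cos χ * Real.sin θ,
        Real.sin χ * Real.cos φ, Real.sin χ * Real.sin φ] : E4)‖ ^ 2 = 1 := by
      rw [EuclideanSpace.norm_sq_eq]
      simp [Fin.sum_univ_four]
      linear_combination Real.cos χ ^ 2 * Real.sin_sq_add_cos_sq θ +
        Real.sin χ ^ 2 * Real.sin_sq_add_cos_sq φ + Real.sin_sq_add_cos_sq χ
    rw [mem_sphere_zero_iff_norm]
    exact (pow_eq_one_iff_of_nonneg (norm_nonneg _) two_ne_zero).1 h⟩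

/-- In toroidal coordinates the generator of the deck group is a translation. -/
theorem gen_toroidal (p : ℕ) (q : ℤ) (χ θ φ : ℝ) :
    gen p q (toroidal χ θ φ) =
      toroidal χ (θ + 2 * Real.pi / p) (φ + 2 * Real.pi * q / p) := by
  ext i
  fin_cases i <;>
    simp [gen, spherePerm, rot, toroidal, Real.cos_add, Real.sin_add] <;> ring

/-- The circular harmonic of integer index `n`: `cos (|n| t)` for `n ≥ 0`, `sin (|n| t)` for
`n < 0`. -/
def circ (n : ℤ) (t : ℝ) : ℝ :=
  if 0 ≤ n then Real.cos (n.natAbs * t) else Real.sin (n.natAbs * t)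

/-- The Jacobi polynomial `P_d^{(a, b)}` with natural number parameters. -/
def jacobi (a b d : ℕ) (u : ℝ) : ℝ :=
  1 / 2 ^ d * ∑ i ∈ Finset.range (d + 1),
    ((a + d).choose i : ℝ) * ((b + d).choose (d - i) : ℝ) * (u + 1) ^ i * (u - 1) ^ (d - i)

/-- The condition under which the eigenmode with indices `k, ℓ, m` exists. -/
def Admissible (k : ℕ) (l m : ℤ) : Prop :=
  |l| + |m| ≤ (k : ℤ) ∧ l + m ≡ k [ZMOD 2]

/-- `d = (k - (|ℓ| + |m|)) / 2`, an exact division of a nonnegative number for admissible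
indices. -/
def deg (k : ℕ) (l m : ℤ) : ℕ := (k - (l.natAbs + m.natAbs)) / 2

/-- The unnormalized eigenmode in toroidal coordinates. -/
def psiTilde (k : ℕ) (l m : ℤ) (χ θ φ : ℝ) : ℝ :=
  Real.cos χ ^ l.natAbs * Real.sin χ ^ m.natAbs *
    jacobi m.natAbs l.natAbs (deg k l m) (Real.cos (2 * χ)) * circ l θ * circ m φ

/-- The norm of `psiTilde k l m` in `L²` of the 3-sphere, for admissible indices. -/
def psiNorm (k : ℕ) (l m : ℤ) : ℝ :=
  √(2 ^ ((if l = 0 then 1 else 0) + (if m = 0 then 1 else 0) : ℕ)) * Real.pi *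
    √(((l.natAbs + deg k l m).factorial * (m.natAbs + deg k l m).factorial : ℝ) /
      (2 * (k + 1) * (deg k l m).factorial * (l.natAbs + m.natAbs + deg k l m).factorial))

/-- The normalized eigenmode `Ψ_{kℓm}` in toroidal coordinates. -/
def psi (k : ℕ) (l m : ℤ) (χ θ φ : ℝ) : ℝ := psiTilde k l m χ θ φ / psiNorm k l m

/-! ### The eigenbasis of the lens space -/

/-- The list of the basis vectors of `L(p, q)` with wave number `k`. In `lMode` and `mMode` the
nonzero index takes both signs; in the four last families the indices are positive. -/
inductive Mode (p : ℕ) (q : ℤ) (k : ℕ) : Type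
  | zero (h : Admissible k 0 0) : Mode p q k
  | lMode (l : ℤ) (hl : l ≠ 0) (h : Admissible k l 0) (hc : l ≡ 0 [ZMOD p]) : Mode p q k
  | mMode (m : ℤ) (hm : m ≠ 0) (h : Admissible k 0 m) (hc : q * m ≡ 0 [ZMOD p]) : Mode p q k
  | e1 (l m : ℤ) (hl : 0 < l) (hm : 0 < m) (h : Admissible k l m)
      (hc : l ≡ q * m [ZMOD p]) : Mode p q k
  | e2 (l m : ℤ) (hl : 0 < l) (hm : 0 < m) (h : Admissible k l m)
      (hc : l ≡ q * m [ZMOD p]) : Mode p q k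
  | e3 (l m : ℤ) (hl : 0 < l) (hm : 0 < m) (h : Admissible k l m)
      (hc : l ≡ -(q * m) [ZMOD p]) : Mode p q k
  | e4 (l m : ℤ) (hl : 0 < l) (hm : 0 < m) (h : Admissible k l m)
      (hc : l ≡ -(q * m) [ZMOD p]) : Mode p q k

/-- The lift of a basis vector to the 3-sphere, in toroidal coordinates. -/
def Mode.toFun {p : ℕ} {q : ℤ} {k : ℕ} (i : Mode p q k) (χ θ φ : ℝ) : ℝ :=
  match i with
  | .zero _ => psi k 0 0 χ θ φ
  | .lMode l _ _ _ => psi k l 0 χ θ φ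
  | .mMode m _ _ _ => psi k 0 m χ θ φ
  | .e1 l m _ _ _ _ => √(1 / 2) * (psi k l m χ θ φ + psi k (-l) (-m) χ θ φ)
  | .e2 l m _ _ _ _ => √(1 / 2) * (psi k (-l) m χ θ φ - psi k l (-m) χ θ φ)
  | .e3 l m _ _ _ _ => √(1 / 2) * (psi k l m χ θ φ - psi k (-l) (-m) χ θ φ)
  | .e4 l m _ _ _ _ => √(1 / 2) * (psi k (-l) m χ θ φ + psi k l (-m) χ θ φ)

end LensSpace

end

/-!
Write a point of the sphere as a pair of complex numbers `(z, w) = (cos χ e^{iθ}, sin χ e^{iφ})`.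
Then `Ψ_{kℓm}` is, up to a constant, a real or imaginary part, or a sum of such parts, of
polynomials `h_{dℓm} = z^ℓ w^m P_d(z z̄, w w̄)`, where `P_d` is the homogenized Jacobi polynomial
and a negative exponent stands for a power of the conjugate. These polynomials are harmonic, so by
Euler's identity their restrictions to the sphere are eigenfunctions of the Laplacian for
`-k (k + 2)`, where `k = |ℓ| + |m| + 2 d`. Two of them are orthogonal either because their weights
`(ℓ, m)` under the torus of rotations in `θ` and `φ` differ, or because they have different
eigenvalues and the Laplacian of the sphere is symmetric; their norms come from the orthogonality
of the Jacobi polynomials. For fixed `(ℓ, m)` the polynomials `P_d(z z̄, 1 - z z̄)`, one in each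
degree, span all polynomials in `z z̄`, so on the sphere the `h_{dℓm}` span all polynomials, and
by the Stone–Weierstrass theorem a continuous function orthogonal to all of them vanishes.

The generator of the cyclic group multiplies `h_{dℓm}` by `exp(2 π i (ℓ + q m) / p)`. A function
on the lens space is therefore orthogonal to `h_{dℓm}` unless `p ∣ ℓ + q m`, and the real and
imaginary parts of the remaining `h_{dℓm}`, one of each conjugate pair, are the listed functions.
-/

noncomputable section

namespace LensSpace

open MeasureTheory ComplexConjugate

/-! ### The Euclidean Laplacian -/

section Laplacian

variable {ι E A : Type*} [Fintype ι] [NormedAddCommGroup E] [InnerProductSpace ℝ E]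

theorem fderiv_real_comp_apply {g : E → ℝ} {ρ : ℝ → ℝ} {y : E} (hg : DifferentiableAt ℝ g y)
    (hρ : DifferentiableAt ℝ ρ (g y)) (v : E) :
    fderiv ℝ (fun x => ρ (g x)) y v = deriv ρ (g y) * fderiv ℝ g y v := by
  have h : HasFDerivAt (fun x => ρ (g x)) (deriv ρ (g y) • fderiv ℝ g y) y :=
    hρ.hasDerivAt.comp_hasFDerivAt y hg.hasFDerivAt
  simp [h.fderiv]

section Module

variable [NormedAddCommGroup A] [NormedSpace ℝ A] {f : E → A} {y : E}

theorem contDiffAt_fderiv_apply {m n : WithTop ℕ∞} (hf : ContDiffAt ℝ n f y) (hmn : m + 1 ≤ n)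
    (v : E) : ContDiffAt ℝ m (fun x => fderiv ℝ f x v) y :=
  (hf.fderiv_right hmn).clm_apply contDiffAt_const

theorem differentiableAt_fderiv_apply (hf : ContDiffAt ℝ 2 f y) (v : E) :
    DifferentiableAt ℝ (fun x => fderiv ℝ f x v) y :=
  (contDiffAt_fderiv_apply (m := 1) hf (by norm_num) v).differentiableAt (by norm_num)

theorem fderiv_self_eq_zero_of_const_on_ray (hf : DifferentiableAt ℝ f y)
    (hray : ∀ r : ℝ, 0 < r → f (r • y) = f y) :
    fderiv ℝ f y y = 0 := by
  have hline : HasDerivAt (fun r : ℝ => f (r • y)) (fderiv ℝ f y y) 1 := by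
    have hsmul : HasDerivAt (fun r : ℝ => r • y) y 1 := by
      simpa using (hasDerivAt_id (1 : ℝ)).smul_const y
    exact hf.hasFDerivAt.comp_hasDerivAt_of_eq 1 hsmul (one_smul ℝ y).symm
  refine hline.unique ((hasDerivAt_const 1 (f y)).congr_of_eventuallyEq ?_)
  filter_upwards [lt_mem_nhds one_pos] with r hr using hray r hr

variable [FiniteDimensional ℝ E]

theorem laplacian_eq_sum_fderiv (b : OrthonormalBasis ι ℝ E) (hf : ContDiffAt ℝ 2 f y) :
    Δ f y = ∑ i, fderiv ℝ (fun x => fderiv ℝ f x (b i)) y (b i) := by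
  have hd : DifferentiableAt ℝ (fderiv ℝ f) y :=
    (hf.fderiv_right (m := 1) (by norm_num)).differentiableAt (by norm_num)
  rw [InnerProductSpace.laplacian_eq_iteratedFDeriv_orthonormalBasis f b]
  refine Finset.sum_congr rfl fun i _ => ?_
  simp [iteratedFDeriv_two_apply, fderiv_clm_apply hd (differentiableAt_const _)]

theorem continuousAt_laplacian (hf : ContDiffAt ℝ 2 f y) : ContinuousAt (Δ f) y := by
  let b := stdOrthonormalBasis ℝ E
  have hΔ : Δ f =ᶠ[nhds y] fun x => ∑ i, fderiv ℝ (fun x => fderiv ℝ f x (b i)) x (b i) := by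
    filter_upwards [hf.eventually (by simp)] with x hx using laplacian_eq_sum_fderiv b hx
  rw [continuousAt_congr hΔ]
  exact tendsto_finsetSum _ fun i _ => (contDiffAt_fderiv_apply (m := 0)
    (contDiffAt_fderiv_apply (m := 1) hf (by norm_num) _) (by norm_num) _).continuousAt

theorem laplacian_comp_const_smul (r : ℝ) (hf : ContDiffAt ℝ 2 f (r • y)) :
    Δ (fun x => f (r • x)) y = r ^ 2 • Δ f (r • y) := by
  let b := stdOrthonormalBasis ℝ E
  have hfr : ContDiffAt ℝ 2 (fun x => f (r • x)) y :=
    hf.comp (g := f) y (contDiff_const_smul r).contDiffAt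
  rw [laplacian_eq_sum_fderiv b hf, laplacian_eq_sum_fderiv b hfr, Finset.smul_sum]
  refine Finset.sum_congr rfl fun i _ => ?_
  have hd : DifferentiableAt ℝ (fun x => fderiv ℝ f (r • x) (b i)) y :=
    (differentiableAt_fderiv_apply hf (b i)).comp (g := fun x => fderiv ℝ f x (b i)) y
      (differentiableAt_id.const_smul r)
  simp_rw [fderiv_comp_smul (f := f), smul_apply]
  rw [fderiv_fun_const_smul hd, fderiv_comp_smul (f := fun x => fderiv ℝ f x (b i)), smul_apply,
    smul_apply, smul_smul, pow_two]

end Module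

variable [FiniteDimensional ℝ E]

theorem laplacian_mul [NormedCommRing A] [NormedAlgebra ℝ A] (b : OrthonormalBasis ι ℝ E)
    {f g : E → A} {y : E} (hf : ContDiffAt ℝ 2 f y) (hg : ContDiffAt ℝ 2 g y) :
    Δ (fun x => f x * g x) y =
      f y * Δ g y + g y * Δ f y + 2 * ∑ i, fderiv ℝ f y (b i) * fderiv ℝ g y (b i) := by
  have hfd := hf.differentiableAt (by norm_num)
  have hgd := hg.differentiableAt (by norm_num)
  have product_rule (v : E) : (fun x => fderiv ℝ (fun x => f x * g x) x v) =ᶠ[nhds y]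
      fun x => f x * fderiv ℝ g x v + g x * fderiv ℝ f x v := by
    filter_upwards [hf.eventually (by simp), hg.eventually (by simp)] with x hx hx'
    simp [fderiv_fun_mul (hx.differentiableAt (by norm_num)) (hx'.differentiableAt (by norm_num))]
  rw [laplacian_eq_sum_fderiv b (hf.mul hg), laplacian_eq_sum_fderiv b hf,
    laplacian_eq_sum_fderiv b hg]
  simp only [Finset.mul_sum, ← Finset.sum_add_distrib]
  refine Finset.sum_congr rfl fun i _ => ?_
  have hfi := differentiableAt_fderiv_apply hf (b i)
  have hgi := differentiableAt_fderiv_apply hg (b i)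
  rw [(product_rule _).fderiv_eq, fderiv_fun_add (hfd.fun_mul hgi) (hgd.fun_mul hfi),
    fderiv_fun_mul hfd hgi, fderiv_fun_mul hgd hfi]
  simp only [add_apply, smul_apply, smul_eq_mul]
  ring

theorem laplacian_real_comp (b : OrthonormalBasis ι ℝ E) {g : E → ℝ} {ρ : ℝ → ℝ} {y : E}
    (hg : ContDiffAt ℝ 2 g y) (hρ : ContDiffAt ℝ 2 ρ (g y)) :
    Δ (fun x => ρ (g x)) y =
      deriv ρ (g y) * Δ g y + deriv (deriv ρ) (g y) * ∑ i, fderiv ℝ g y (b i) ^ 2 := by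
  have hgd := hg.differentiableAt (by norm_num)
  have hρ' : DifferentiableAt ℝ (deriv ρ) (g y) :=
    (differentiableAt_fderiv_apply hρ 1).congr_of_eventuallyEq (by simp)
  have chain_rule (v : E) : (fun x => fderiv ℝ (fun x => ρ (g x)) x v) =ᶠ[nhds y]
      fun x => deriv ρ (g x) * fderiv ℝ g x v := by
    filter_upwards [hg.eventually (by simp), hg.continuousAt.eventually (hρ.eventually (by simp))]
      with x hx hx' using fderiv_real_comp_apply (hx.differentiableAt (by norm_num))
        (hx'.differentiableAt (by norm_num)) v
  rw [laplacian_eq_sum_fderiv b (hρ.fun_comp y hg), laplacian_eq_sum_fderiv b hg]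
  simp only [Finset.mul_sum, ← Finset.sum_add_distrib]
  refine Finset.sum_congr rfl fun i _ => ?_
  rw [(chain_rule _).fderiv_eq,
    fderiv_fun_mul (hρ'.fun_comp' y hgd) (differentiableAt_fderiv_apply hg (b i))]
  simp only [add_apply, smul_apply, smul_eq_mul, fderiv_real_comp_apply hgd hρ']
  ring

theorem laplacian_norm_sq (y : E) :
    Δ (fun x : E => ‖x‖ ^ 2) y = 2 * Module.finrank ℝ E := by
  have second_deriv (v : E) :
      fderiv ℝ (fun x => fderiv ℝ (fun x : E => ‖x‖ ^ 2) x v) y v = 2 * ‖v‖ ^ 2 := by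
    have h : (fun x => fderiv ℝ (fun x : E => ‖x‖ ^ 2) x v) = ⇑((2 : ℝ) • innerSL ℝ v) := by
      funext x
      simp [real_inner_comm]
    rw [h, ContinuousLinearMap.fderiv]
    simp
  rw [laplacian_eq_sum_fderiv (stdOrthonormalBasis ℝ E) (contDiff_norm_sq ℝ).contDiffAt]
  simp_rw [second_deriv]
  simp [mul_comm]

theorem laplacian_norm_sq_rpow (s : ℝ) {y : E} (hy : y ≠ 0) :
    Δ (fun x : E => (‖x‖ ^ 2) ^ s) y =
      2 * s * (2 * s + Module.finrank ℝ E - 2) * (‖y‖ ^ 2) ^ (s - 1) := by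
  have hy2 : 0 < ‖y‖ ^ 2 := by positivity
  have grad_sq : ∑ i, fderiv ℝ (fun x : E => ‖x‖ ^ 2) y (stdOrthonormalBasis ℝ E i) ^ 2 =
      4 * ‖y‖ ^ 2 := by
    simp only [fderiv_norm_sq_apply, smul_apply, coe_innerSL_apply, nsmul_eq_mul, mul_pow,
      ← Finset.mul_sum, OrthonormalBasis.sum_sq_inner_left]
    norm_num
  rw [laplacian_real_comp (stdOrthonormalBasis ℝ E) (contDiff_norm_sq ℝ).contDiffAt
    (Real.contDiffAt_rpow_const_of_ne hy2.ne'), laplacian_norm_sq, grad_sq, Real.deriv_rpow_const',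
    deriv_const_mul_field, Real.deriv_rpow_const, Real.rpow_sub_one hy2.ne' (s - 1)]
  field_simp
  ring

-- The gradients of the two factors are orthogonal.
theorem laplacian_radial_mul {f : E → ℝ} {ρ : ℝ → ℝ} {y : E} (hf : ContDiffAt ℝ 2 f y)
    (hρ : ContDiffAt ℝ 2 ρ (‖y‖ ^ 2)) (hray : ∀ r : ℝ, 0 < r → f (r • y) = f y) :
    Δ (fun x => ρ (‖x‖ ^ 2) * f x) y =
      ρ (‖y‖ ^ 2) * Δ f y + f y * Δ (fun x : E => ρ (‖x‖ ^ 2)) y := by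
  let b := stdOrthonormalBasis ℝ E
  have hN : ContDiffAt ℝ 2 (fun x : E => ‖x‖ ^ 2) y := (contDiff_norm_sq ℝ).contDiffAt
  have grad_radial (i) : fderiv ℝ (fun x => ρ (‖x‖ ^ 2)) y (b i) =
      2 * deriv ρ (‖y‖ ^ 2) * b.repr y i := by
    rw [fderiv_real_comp_apply (hN.differentiableAt (by norm_num))
      (hρ.differentiableAt (by norm_num)), fderiv_norm_sq_apply, b.repr_apply_apply,
      real_inner_comm]
    simp only [smul_apply, coe_innerSL_apply, nsmul_eq_mul, Nat.cast_ofNat]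
    ring
  have radial_deriv : ∑ i, b.repr y i * fderiv ℝ f y (b i) = 0 := by
    rw [← fderiv_self_eq_zero_of_const_on_ray (hf.differentiableAt (by norm_num)) hray]
    simpa using (congrArg (fderiv ℝ f y) (b.sum_repr y))
  rw [laplacian_mul b (hρ.fun_comp y hN) hf]
  simp only [grad_radial, mul_assoc, ← Finset.mul_sum, radial_deriv]
  ring

end Laplacian

/-! ### Functions on the sphere and their radial extensions -/

section RadialExtension

theorem radialExt_smul (F : S3 → ℝ) {r : ℝ} (hr : 0 < r) (y : E4) :
    radialExt F (r • y) = radialExt F y := by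
  by_cases hy : y = 0
  · simp [hy]
  · rw [radialExt, radialExt, dif_pos hy, dif_pos (smul_ne_zero hr.ne' hy)]
    congr 1
    ext1
    simp only [radialProj, norm_smul, Real.norm_eq_abs, abs_of_pos hr, smul_smul]
    congr 1
    field_simp

theorem radialExt_coe (F : S3 → ℝ) (x : S3) : radialExt F x = F x := by
  rw [radialExt, dif_pos (ne_zero_of_mem_unit_sphere x)]
  congr 1
  ext1
  simp [radialProj]

theorem radialExt_smul_coe (F : S3 → ℝ) {r : ℝ} (hr : 0 < r) (x : S3) :
    radialExt F (r • (x : E4)) = F x := by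
  rw [radialExt_smul F hr, radialExt_coe]

theorem exists_eq_smul_coe {y : E4} (hy : y ≠ 0) : ∃ r : ℝ, 0 < r ∧ ∃ x : S3, y = r • (x : E4) :=
  ⟨‖y‖, norm_pos_iff.2 hy, radialProj y hy, by simp [radialProj, hy]⟩

variable {F : S3 → ℝ}

theorem IsSmooth3.continuous (hF : IsSmooth3 F) : Continuous F :=
  ContMDiff.continuous hF

theorem IsSmooth3.contDiffAt_radialExt (hF : IsSmooth3 F) {y : E4} (hy : y ≠ 0) :
    ContDiffAt ℝ ∞ (radialExt F) y := by
  obtain ⟨r, hr, x, rfl⟩ := exists_eq_smul_coe hy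
  have hscale : radialExt F = radialExt F ∘ fun y => r⁻¹ • y := by
    funext y
    rw [Function.comp_apply, radialExt_smul F (inv_pos.2 hr)]
  rw [hscale]
  refine ContDiffAt.comp _ ?_ (contDiff_const_smul r⁻¹).contDiffAt
  rw [inv_smul_smul₀ hr.ne']
  exact radialExt_contDiffAt hF x

theorem laplacian_radialExt_smul (hF : IsSmooth3 F) {r : ℝ} (hr : 0 < r) (x : S3) :
    Δ (radialExt F) (r • (x : E4)) = (r ^ 2)⁻¹ * sphereLaplacian F x := by
  have hrx : r • (x : E4) ≠ 0 := smul_ne_zero hr.ne' (ne_zero_of_mem_unit_sphere x)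
  have h := laplacian_comp_const_smul r ((hF.contDiffAt_radialExt hrx).of_le (by norm_cast))
  simp only [radialExt_smul F hr, smul_eq_mul] at h
  rw [sphereLaplacian, h, inv_mul_cancel_left₀ (by positivity)]

theorem IsSmooth3.continuous_sphereLaplacian (hF : IsSmooth3 F) :
    Continuous (sphereLaplacian F) := by
  rw [continuous_iff_continuousAt]
  intro x
  exact (continuousAt_laplacian ((radialExt_contDiffAt hF x).of_le (by norm_cast))).comp
    continuous_subtype_val.continuousAt

theorem isSmooth3_restrict {u : E4 → ℝ} (hu : ContDiff ℝ ∞ u) : IsSmooth3 fun x : S3 => u x :=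
  hu.contMDiff.comp (contMDiff_coe_sphere (n := 3))

theorem sphereLaplacian_restrict {u : E4 → ℝ} (hu : ContDiff ℝ ∞ u) (n : ℕ)
    (hn : ∀ (r : ℝ) (y : E4), 0 < r → u (r • y) = r ^ n * u y) (x : S3) :
    sphereLaplacian (fun x : S3 => u x) x = Δ u (x : E4) - n * (n + 2) * u x := by
  set F : S3 → ℝ := fun x => u x with hF
  have hx0 : (x : E4) ≠ 0 := ne_zero_of_mem_unit_sphere x
  have hx : ‖(x : E4)‖ = 1 := by simp
  have polar : u =ᶠ[nhds (x : E4)] fun y => (‖y‖ ^ 2) ^ (n / 2 : ℝ) * radialExt F y := by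
    filter_upwards [isOpen_ne.mem_nhds hx0] with y hy
    obtain ⟨r, hr, x, rfl⟩ := exists_eq_smul_coe hy
    have hrn : (r ^ 2) ^ (n / 2 : ℝ) = r ^ n := by
      rw [← Real.rpow_natCast_mul hr.le, Nat.cast_ofNat, mul_div_cancel₀ _ two_ne_zero,
        Real.rpow_natCast]
    rw [radialExt_smul_coe F hr, hn r _ hr, norm_smul, norm_eq_of_mem_sphere, mul_one,
      Real.norm_eq_abs, sq_abs, hrn]
  have hρ : ContDiffAt ℝ 2 (fun s : ℝ => s ^ (n / 2 : ℝ)) (‖(x : E4)‖ ^ 2) :=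
    Real.contDiffAt_rpow_const_of_ne (by simp)
  rw [(InnerProductSpace.laplacian_congr_nhds polar).eq_of_nhds,
    laplacian_radial_mul ((radialExt_contDiffAt (isSmooth3_restrict hu) x).of_le (by norm_cast)) hρ
      fun r hr => radialExt_smul F hr _, laplacian_norm_sq_rpow _ hx0, radialExt_coe, hx,
    finrank_euclideanSpace_fin]
  simp only [hF, sphereLaplacian, one_pow, Real.one_rpow]
  push_cast
  ring

end RadialExtension

/-! ### Integration on the sphere -/

section Integration

theorem integral_eq_integral_toSphere_mul {E : Type*} [NormedAddCommGroup E] [NormedSpace ℝ E]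
    [FiniteDimensional ℝ E] [Nontrivial E] [MeasurableSpace E] [BorelSpace E] (μ : Measure E)
    [μ.IsAddHaarMeasure] {h : E → ℝ} {a : ℝ → ℝ} {F : Metric.sphere (0 : E) 1 → ℝ}
    (hh : ∀ (r : ℝ) (x : Metric.sphere (0 : E) 1), 0 < r → h (r • (x : E)) = F x * a r) :
    ∫ y, h y ∂μ = (∫ x, F x ∂μ.toSphere) *
      ∫ r : Set.Ioi (0 : ℝ), a r ∂(Measure.volumeIoiPow (Module.finrank ℝ E - 1)) := by
  calc
    ∫ y, h y ∂μ = ∫ y : ({0}ᶜ : Set E), h y ∂(μ.comap (↑)) := by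
      rw [integral_subtype_comap (measurableSet_singleton _).compl fun y ↦ h y,
        restrict_compl_singleton]
    _ = ∫ x, F x.1 * a x.2 ∂μ.toSphere.prod (.volumeIoiPow (Module.finrank ℝ E - 1)) := by
      rw [← μ.measurePreserving_homeomorphUnitSphereProd.integral_comp
        (Homeomorph.measurableEmbedding _) (fun x => F x.1 * a x.2)]
      refine integral_congr_ae (.of_forall fun y => ?_)
      have hy : 0 < ‖(y : E)‖ := norm_pos_iff.2 y.2
      simp only [homeomorphUnitSphereProd_apply_snd_coe]
      rw [← hh _ _ hy, homeomorphUnitSphereProd_apply_fst_coe, smul_inv_smul₀ hy.ne']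
    _ = _ := integral_prod_mul F fun r : Set.Ioi (0 : ℝ) => a r

instance : IsFiniteMeasure vol3 := by unfold vol3; infer_instance

instance : vol3.IsOpenPosMeasure := by unfold vol3; infer_instance

theorem integrable_of_continuous {X A : Type*} [TopologicalSpace X] [CompactSpace X]
    [MeasurableSpace X] [OpensMeasurableSpace X] {μ : Measure X} [IsFiniteMeasure μ]
    [NormedAddCommGroup A] {f : X → A} (hf : Continuous f) : Integrable f μ :=
  hf.integrable_of_hasCompactSupport (.of_compactSpace f)

theorem measureReal_vol3_univ : vol3.real Set.univ = 2 * Real.pi ^ 2 := by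
  have hGamma : Real.Gamma ((4 : ℕ) / 2 + 1 : ℝ) = 2 := by
    norm_num [Real.Gamma_ofNat_eq_factorial]
  have hsqrt : √Real.pi ^ 4 = Real.pi ^ 2 := by
    rw [show 4 = 2 * 2 from rfl, pow_mul, Real.sq_sqrt Real.pi_pos.le]
  rw [vol3, Measure.toSphere_real_apply_univ, finrank_euclideanSpace_fin, measureReal_def,
    EuclideanSpace.volume_ball, Fintype.card_fin, hGamma, hsqrt, ENNReal.ofReal_one, one_pow,
    one_mul, ENNReal.toReal_ofReal (by positivity)]
  push_cast
  ring

variable (L : E4 ≃ₗᵢ[ℝ] E4)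

theorem continuous_spherePerm : Continuous (spherePerm L) :=
  (L.continuous.comp continuous_subtype_val).subtype_mk _

open scoped Pointwise in
theorem measurePreserving_spherePerm : MeasurePreserving (spherePerm L) vol3 vol3 := by
  have hm := (continuous_spherePerm L).measurable
  have preimage_coe (s : Set S3) :
      ((↑) '' (spherePerm L ⁻¹' s) : Set E4) = L ⁻¹' ((↑) '' s) := by
    ext y
    constructor
    · rintro ⟨x, hx, rfl⟩
      exact ⟨_, hx, rfl⟩
    · rintro ⟨x, hx, hxy⟩
      exact ⟨(spherePerm L).symm x, by simpa using hx, L.injective (by simp [← hxy, spherePerm])⟩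
  have preimage_cone (I : Set ℝ) (t : Set E4) : I • (L ⁻¹' t) = L ⁻¹' (I • t) := by
    ext y
    constructor
    · rintro ⟨r, hr, x, hx, rfl⟩
      exact ⟨r, hr, L x, hx, by simp⟩
    · rintro ⟨r, hr, x, hx, hxy⟩
      exact ⟨r, hr, L.symm x, by simpa using hx, L.injective (by simpa using hxy)⟩
  refine ⟨hm, Measure.ext fun s hs => ?_⟩
  rw [Measure.map_apply hm hs, vol3, Measure.toSphere_apply' _ (hm hs),
    Measure.toSphere_apply' _ hs, preimage_coe, preimage_cone,
    L.measurePreserving.measure_preimage_emb L.toHomeomorph.measurableEmbedding]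

theorem integral_comp_spherePerm {A : Type*} [NormedAddCommGroup A] [NormedSpace ℝ A]
    (F : S3 → A) : ∫ x, F (spherePerm L x) ∂vol3 = ∫ x, F x ∂vol3 :=
  (measurePreserving_spherePerm L).integral_comp
    ((continuous_spherePerm L).measurableEmbedding (spherePerm L).injective) F

theorem integral_eq_zero_of_comp_spherePerm {F : S3 → ℂ} {c : ℂ} (hc : c ≠ 1)
    (hF : ∀ x, F (spherePerm L x) = c * F x) : ∫ x, F x ∂vol3 = 0 := by
  have h : ∫ x, F x ∂vol3 = c * ∫ x, F x ∂vol3 := by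
    rw [← integral_const_mul, ← integral_comp_spherePerm L]
    simp only [hF]
  exact (mul_eq_zero.1 (by linear_combination h : (1 - c) * ∫ x, F x ∂vol3 = 0)).resolve_left
    (sub_ne_zero.2 hc.symm)

end Integration

/-! ### Symmetry of the Laplacian of the sphere -/

section Symmetry

/-- A smooth cutoff function on the line, supported in `[1/2, 3/2]`. As a function of `‖y‖ ^ 2` it
localizes the homogeneous extension of a function on the sphere to a shell around the sphere. -/
def cutoff : ContDiffBump (1 : ℝ) := ⟨1 / 4, 1 / 2, by norm_num, by norm_num⟩

theorem cutoff_one : cutoff 1 = 1 := cutoff.one_of_mem_closedBall (by simp [cutoff])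

theorem cutoff_eq_zero {s : ℝ} (hs : 1 / 2 ≤ |s - 1|) : cutoff s = 0 :=
  cutoff.zero_of_le_dist hs

theorem hasCompactSupport_cutoff_mul (f : E4 → ℝ) :
    HasCompactSupport fun y : E4 => cutoff (‖y‖ ^ 2) * f y := by
  refine HasCompactSupport.intro (isCompact_closedBall (0 : E4) 2) fun y hy => ?_
  rw [mem_closedBall_zero_iff, not_le] at hy
  rw [cutoff_eq_zero (le_abs.2 (.inl (by nlinarith))), zero_mul]

theorem contDiff_cutoff_mul {f : E4 → ℝ} (hf : ∀ y, y ≠ 0 → ContDiffAt ℝ ∞ f y) :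
    ContDiff ℝ ∞ fun y : E4 => cutoff (‖y‖ ^ 2) * f y := by
  rw [contDiff_iff_contDiffAt]
  intro y
  by_cases hy : y = 0
  · subst hy
    have hsmall : ∀ᶠ y : E4 in nhds 0, ‖y‖ ^ 2 < 1 / 2 :=
      (continuous_norm.pow 2).continuousAt.eventually (gt_mem_nhds (by simp))
    refine (contDiffAt_const (c := (0 : ℝ))).congr_of_eventuallyEq ?_
    filter_upwards [hsmall] with y hy
    rw [cutoff_eq_zero (le_abs.2 (.inr (by linarith))), zero_mul]
  · exact (cutoff.contDiff.comp (contDiff_norm_sq ℝ)).contDiffAt.mul (hf y hy)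

theorem integral_cutoff_ne_zero :
    ∫ r : Set.Ioi (0 : ℝ), cutoff (r.1 ^ 2) * (cutoff (r.1 ^ 2) * (r.1 ^ 2)⁻¹)
      ∂(Measure.volumeIoiPow 3) ≠ 0 := by
  have polar := integral_eq_integral_toSphere_mul (volume : Measure E4) (F := fun _ => 1)
    (h := fun y => cutoff (‖y‖ ^ 2) * (cutoff (‖y‖ ^ 2) * (‖y‖ ^ 2)⁻¹))
    (a := fun r => cutoff (r ^ 2) * (cutoff (r ^ 2) * (r ^ 2)⁻¹)) fun r x _ => by simp [norm_smul]
  have hcont : Continuous fun y : E4 => cutoff (‖y‖ ^ 2) * (cutoff (‖y‖ ^ 2) * (‖y‖ ^ 2)⁻¹) :=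
    (contDiff_cutoff_mul fun _ _ => (contDiff_cutoff_mul fun _ hy =>
      (contDiff_norm_sq ℝ).contDiffAt.inv (by simpa using hy)).contDiffAt).continuous
  have hpos : 0 < ∫ y : E4, cutoff (‖y‖ ^ 2) * (cutoff (‖y‖ ^ 2) * (‖y‖ ^ 2)⁻¹) := by
    refine hcont.integral_pos_of_hasCompactSupport_nonneg_nonzero (hasCompactSupport_cutoff_mul _)
      (fun y => ?_) (x := EuclideanSpace.single 0 1) (by simp [cutoff_one])
    have := cutoff.nonneg (x := ‖y‖ ^ 2)
    positivity
  rw [finrank_euclideanSpace_fin] at polar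
  intro h0
  rw [h0, mul_zero] at polar
  exact hpos.ne' polar

theorem laplacian_cutoff_mul_radialExt {F : S3 → ℝ} (hF : IsSmooth3 F) {r : ℝ} (hr : 0 < r)
    (x : S3) : Δ (fun y => cutoff (‖y‖ ^ 2) * radialExt F y) (r • (x : E4)) =
      cutoff (r ^ 2) * ((r ^ 2)⁻¹ * sphereLaplacian F x) +
        F x * Δ (fun y : E4 => cutoff (‖y‖ ^ 2)) (r • (x : E4)) := by
  have hrx : r • (x : E4) ≠ 0 := smul_ne_zero hr.ne' (ne_zero_of_mem_unit_sphere x)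
  rw [laplacian_radial_mul ((hF.contDiffAt_radialExt hrx).of_le (by norm_cast))
    cutoff.contDiff.contDiffAt fun r hr => radialExt_smul F hr _, laplacian_radialExt_smul hF hr,
    radialExt_smul_coe F hr, norm_smul, norm_eq_of_mem_sphere, mul_one, Real.norm_eq_abs, sq_abs]

theorem integral_mul_laplacian_sub_eq_zero {E : Type*} [NormedAddCommGroup E]
    [InnerProductSpace ℝ E] [FiniteDimensional ℝ E] [MeasurableSpace E] [BorelSpace E]
    {u v : E → ℝ} (hu : ContDiff ℝ ∞ u) (hu' : HasCompactSupport u) (hv : ContDiff ℝ ∞ v)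
    (hv' : HasCompactSupport v) : ∫ y, (u y * Δ v y - Δ u y * v y) = 0 := by
  let u' := hu'.toSchwartzMap hu
  let v' := hv'.toSchwartzMap hv
  have h : ∫ y, (u' y * Δ v' y - Δ u' y * v' y) = 0 := by
    rw [integral_sub, SchwartzMap.integral_mul_laplacian_right_eq_left, sub_self]
    · exact (SchwartzMap.pairing (ContinuousLinearMap.mul ℝ ℝ) u' (Δ v')).integrable
    · exact (SchwartzMap.pairing (ContinuousLinearMap.mul ℝ ℝ) (Δ u') v').integrable
  simp only [SchwartzMap.laplacian_apply] at h
  exact h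

/- Apply Green's identity on `E4` to the localized extensions of `F` and `G`: the terms in which the
Laplacian hits the cutoff cancel, and the radial integral factors out. -/
theorem integral_mul_sphereLaplacian {F G : S3 → ℝ} (hF : IsSmooth3 F) (hG : IsSmooth3 G) :
    ∫ x, F x * sphereLaplacian G x ∂vol3 = ∫ x, sphereLaplacian F x * G x ∂vol3 := by
  have green := integral_mul_laplacian_sub_eq_zero
    (contDiff_cutoff_mul fun _ => hF.contDiffAt_radialExt) (hasCompactSupport_cutoff_mul _)
    (contDiff_cutoff_mul fun _ => hG.contDiffAt_radialExt) (hasCompactSupport_cutoff_mul _)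
  rw [integral_eq_integral_toSphere_mul volume
    (F := fun x => F x * sphereLaplacian G x - sphereLaplacian F x * G x)
    (a := fun r => cutoff (r ^ 2) * (cutoff (r ^ 2) * (r ^ 2)⁻¹)) fun r x hr => ?_,
    finrank_euclideanSpace_fin] at green
  · have h := (mul_eq_zero.1 green).resolve_right integral_cutoff_ne_zero
    rwa [← vol3, integral_sub
      (integrable_of_continuous (hF.continuous.fun_mul hG.continuous_sphereLaplacian))
      (integrable_of_continuous (hF.continuous_sphereLaplacian.fun_mul hG.continuous)),
      sub_eq_zero] at h
  · rw [laplacian_cutoff_mul_radialExt hF hr, laplacian_cutoff_mul_radialExt hG hr,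
      radialExt_smul_coe F hr, radialExt_smul_coe G hr, norm_smul, norm_eq_of_mem_sphere, mul_one,
      Real.norm_eq_abs, sq_abs]
    ring

theorem integral_mul_eq_zero_of_eigenvalue_ne {F G : S3 → ℝ} (hF : IsSmooth3 F) (hG : IsSmooth3 G)
    {a b : ℝ} (hab : a ≠ b) (ha : ∀ x, sphereLaplacian F x = a * F x)
    (hb : ∀ x, sphereLaplacian G x = b * G x) : ∫ x, F x * G x ∂vol3 = 0 := by
  have h := integral_mul_sphereLaplacian hF hG
  simp only [ha, hb, mul_left_comm _ b, mul_assoc a, integral_const_mul] at h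
  exact (mul_eq_mul_right_iff.1 h).resolve_left hab.symm

end Symmetry

/-! ### Harmonic polynomials in complex coordinates -/

section Polynomial

open MvPolynomial

section Eval

variable {σ E A : Type*} [NormedAddCommGroup E] [NormedCommRing A] [NormedAlgebra ℝ A]

theorem contDiff_eval_clm [NormedSpace ℝ E] (ζ : σ → E →L[ℝ] A) (P : MvPolynomial σ A)
    {n : WithTop ℕ∞} : ContDiff ℝ n fun x => eval (fun j => ζ j x) P := by
  simp only [eval_eq]
  fun_prop

theorem fderiv_eval_clm [Fintype σ] [NormedSpace ℝ E] (ζ : σ → E →L[ℝ] A) (P : MvPolynomial σ A)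
    (y v : E) : fderiv ℝ (fun x => eval (fun j => ζ j x) P) y v =
      ∑ j, eval (fun j => ζ j y) (pderiv j P) * ζ j v := by
  classical
  have hd (P : MvPolynomial σ A) : DifferentiableAt ℝ (fun x => eval (fun j => ζ j x) P) y :=
    (contDiff_eval_clm ζ P (n := 1)).contDiffAt.differentiableAt (by norm_num)
  induction P using MvPolynomial.induction_on with
  | C a => simp
  | add P Q hP hQ =>
    simp only [map_add, fderiv_fun_add (hd P) (hd Q), add_apply, hP, hQ, add_mul,
      Finset.sum_add_distrib]
  | mul_X P i hP =>
    simp only [map_mul, eval_X, fderiv_fun_mul (hd P) (ζ i).differentiableAt, add_apply, smul_apply,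
      hP, ContinuousLinearMap.fderiv]
    simp [Derivation.leibniz, pderiv_X, Pi.single_apply, add_mul, Finset.sum_add_distrib,
      Finset.mul_sum, mul_assoc, apply_ite]

theorem pderiv_pderiv_comm {R : Type*} [CommRing R] (i j : σ) (P : MvPolynomial σ R) :
    pderiv i (pderiv j P) = pderiv j (pderiv i P) := by
  classical
  have h : ⁅pderiv (R := R) i, pderiv j⁆ = 0 := derivation_ext fun k => by
    rw [Derivation.commutator_apply]
    simp [pderiv_X, Pi.single_apply, apply_ite]
  have hP := DFunLike.congr_fun h P
  rwa [Derivation.commutator_apply, Derivation.zero_apply, sub_eq_zero] at hP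

theorem laplacian_eval_clm {ι : Type*} [Fintype σ] [Fintype ι] [InnerProductSpace ℝ E]
    [FiniteDimensional ℝ E] (b : OrthonormalBasis ι ℝ E) (ζ : σ → E →L[ℝ] A) (P : MvPolynomial σ A)
    (y : E) : Δ (fun x => eval (fun j => ζ j x) P) y =
      ∑ i, ∑ j, eval (fun j => ζ j y) (pderiv i (pderiv j P)) * ∑ v, ζ i (b v) * ζ j (b v) := by
  rw [laplacian_eq_sum_fderiv b (contDiff_eval_clm ζ P).contDiffAt]
  have fderiv_eval (v : E) : (fun x => fderiv ℝ (fun x => eval (fun j => ζ j x) P) x v) =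
      fun x => eval (fun j => ζ j x) (∑ j, C (ζ j v) * pderiv j P) := by
    funext x
    simp [fderiv_eval_clm, mul_comm]
  simp_rw [fderiv_eval, fderiv_eval_clm]
  simp only [map_sum, pderiv_C_mul, map_mul, eval_C, Finset.sum_mul, Finset.mul_sum]
  rw [Finset.sum_comm]
  refine Finset.sum_congr rfl fun i _ => ?_
  rw [Finset.sum_comm]
  refine Finset.sum_congr rfl fun j _ => Finset.sum_congr rfl fun v _ => ?_
  ring

end Eval

/-- The complex coordinate `x + i y` of `E4`. -/
def zCoord : E4 →L[ℝ] ℂ :=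
  Complex.ofRealCLM.comp (EuclideanSpace.proj 0) +
    Complex.I • Complex.ofRealCLM.comp (EuclideanSpace.proj 1)

/-- The complex coordinate `z + i w` of `E4`. -/
def wCoord : E4 →L[ℝ] ℂ :=
  Complex.ofRealCLM.comp (EuclideanSpace.proj 2) +
    Complex.I • Complex.ofRealCLM.comp (EuclideanSpace.proj 3)

theorem zCoord_apply (y : E4) : zCoord y = y 0 + Complex.I * y 1 := by
  simp [zCoord]

theorem wCoord_apply (y : E4) : wCoord y = y 2 + Complex.I * y 3 := by
  simp [wCoord]

/-- The complex coordinates of `E4` and their conjugates, in the order `z, z̄, w, w̄`. -/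
def complexCoord : Fin 4 → E4 →L[ℝ] ℂ :=
  ![zCoord, (Complex.conjCLE : ℂ →L[ℝ] ℂ).comp zCoord,
    wCoord, (Complex.conjCLE : ℂ →L[ℝ] ℂ).comp wCoord]

/-- The function on `E4` defined by a polynomial in the coordinates `z, z̄, w, w̄`. -/
def polyFun (P : MvPolynomial (Fin 4) ℂ) (y : E4) : ℂ := eval (fun j => complexCoord j y) P

theorem contDiff_polyFun (P : MvPolynomial (Fin 4) ℂ) {n : WithTop ℕ∞} : ContDiff ℝ n (polyFun P) :=
  contDiff_eval_clm complexCoord P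

theorem laplacian_polyFun (P : MvPolynomial (Fin 4) ℂ) (y : E4) :
    Δ (polyFun P) y = 4 * polyFun (pderiv 0 (pderiv 1 P) + pderiv 2 (pderiv 3 P)) y := by
  have pairing (i j : Fin 4) : ∑ v, complexCoord i (EuclideanSpace.basisFun (Fin 4) ℝ v) *
      complexCoord j (EuclideanSpace.basisFun (Fin 4) ℝ v) =
        !![0, 2, 0, 0; 2, 0, 0, 0; 0, 0, 0, 2; 0, 0, 2, 0] i j := by
    fin_cases i <;> fin_cases j <;>
      simp [complexCoord, Fin.sum_univ_four, zCoord_apply, wCoord_apply] <;> norm_num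
  unfold polyFun
  rw [laplacian_eval_clm (EuclideanSpace.basisFun (Fin 4) ℝ)]
  simp only [pairing, Fin.sum_univ_four, Matrix.of_apply, Matrix.cons_val, mul_zero, add_zero,
    zero_add, map_add]
  rw [pderiv_pderiv_comm 1 0, pderiv_pderiv_comm 3 2]
  ring

/-- The monomial `z ^ a z̄ ^ b w ^ c w̄ ^ e`. -/
def coordMonomial (a b c e : ℕ) : MvPolynomial (Fin 4) ℂ :=
  X 0 ^ a * X 1 ^ b * (X 2 ^ c * X 3 ^ e)

theorem polyFun_coordMonomial (a b c e : ℕ) (y : E4) : polyFun (coordMonomial a b c e) y =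
    zCoord y ^ a * conj (zCoord y) ^ b * (wCoord y ^ c * conj (wCoord y) ^ e) := by
  simp [polyFun, coordMonomial, complexCoord]

theorem laplacian_polyFun_C_mul_coordMonomial (r : ℂ) (a b c e : ℕ) (y : E4) :
    Δ (polyFun (C r * coordMonomial a b c e)) y =
      r * (4 * (a * b * polyFun (coordMonomial (a - 1) (b - 1) c e) y +
      c * e * polyFun (coordMonomial a b (c - 1) (e - 1)) y)) := by
  rw [laplacian_polyFun]
  simp only [polyFun, coordMonomial]
  simp [Derivation.leibniz, Derivation.leibniz_pow, pderiv_X]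
  ring

/-- The signed power `z ^ n`, with the conjugate of `z` in place of `z⁻¹` for negative `n`. -/
def signPow (z : ℂ) (n : ℤ) : ℂ := z ^ n.toNat * conj z ^ (-n).toNat

/-- The coefficients of the Jacobi polynomial `P_d^{(a, b)}` in `t ^ i (t - 1) ^ (d - i)`, where
`t = (u + 1) / 2`. -/
def jacobiCoeff (a b d i : ℕ) : ℝ := (a + d).choose i * (b + d).choose (d - i)

theorem jacobiCoeff_succ (a b : ℕ) {d i : ℕ} (hi : i < d) :
    jacobiCoeff a b d (i + 1) * ((b + (i + 1)) * (i + 1)) =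
      jacobiCoeff a b d i * ((a + (d - i : ℕ)) * (d - i : ℕ)) := by
  obtain ⟨j, rfl⟩ : ∃ j, d = i + 1 + j := ⟨d - (i + 1), by omega⟩
  unfold jacobiCoeff
  have choose_a := Nat.choose_succ_right_eq (a + (i + 1 + j)) i
  have choose_b := Nat.choose_succ_right_eq (b + (i + 1 + j)) j
  rw [show a + (i + 1 + j) - i = a + (j + 1) by omega] at choose_a
  rw [show b + (i + 1 + j) - j = b + (i + 1) by omega] at choose_b
  rw [show i + 1 + j - (i + 1) = j by omega, show i + 1 + j - i = j + 1 by omega]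
  rify at choose_a choose_b
  push_cast
  linear_combination ((b + (i + 1 + j)).choose j : ℝ) * (b + (i + 1)) * choose_a -
    ((a + (i + 1 + j)).choose i : ℝ) * (a + (j + 1)) * choose_b

/-- The harmonic polynomial of degree `|l| + |m| + 2 d` that the rotation by `(a, b)` multiplies by
`exp (i (l a + m b))`. Up to a constant factor, `Ψ_{kℓm}` is the real or imaginary part of its
restriction to the sphere. -/
def harm (d : ℕ) (l m : ℤ) (y : E4) : ℂ :=
  signPow (zCoord y) l * signPow (wCoord y) m *
    ∑ i ∈ Finset.range (d + 1), (jacobiCoeff m.natAbs l.natAbs d i : ℂ) *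
      (zCoord y * conj (zCoord y)) ^ i * (-(wCoord y * conj (wCoord y))) ^ (d - i)

/-- `harm` as a polynomial in the coordinates `z, z̄, w, w̄`. -/
def harmPoly (d : ℕ) (l m : ℤ) : MvPolynomial (Fin 4) ℂ :=
  ∑ i ∈ Finset.range (d + 1), C ((-1) ^ (d - i) * (jacobiCoeff m.natAbs l.natAbs d i : ℂ)) *
    coordMonomial (l.toNat + i) ((-l).toNat + i) (m.toNat + (d - i)) ((-m).toNat + (d - i))

theorem polyFun_harmPoly (d : ℕ) (l m : ℤ) : polyFun (harmPoly d l m) = harm d l m := by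
  funext y
  have h (i : ℕ) (c : ℂ) : polyFun (C c * coordMonomial (l.toNat + i) ((-l).toNat + i)
      (m.toNat + (d - i)) ((-m).toNat + (d - i))) y =
    signPow (zCoord y) l * signPow (wCoord y) m *
      (c * (zCoord y * conj (zCoord y)) ^ i * (wCoord y * conj (wCoord y)) ^ (d - i)) := by
    rw [polyFun, map_mul, eval_C, ← polyFun, polyFun_coordMonomial, signPow, signPow]
    ring
  rw [harm, Finset.mul_sum, polyFun, harmPoly, map_sum]
  refine Finset.sum_congr rfl fun i _ => (h i _).trans ?_
  rw [neg_pow (_ * _)]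
  ring

theorem contDiff_harm (d : ℕ) (l m : ℤ) {n : WithTop ℕ∞} : ContDiff ℝ n (harm d l m) :=
  polyFun_harmPoly d l m ▸ contDiff_polyFun _

theorem laplacian_polyFun_sum {ι : Type*} (s : Finset ι) (P : ι → MvPolynomial (Fin 4) ℂ) (y : E4) :
    Δ (polyFun (∑ i ∈ s, P i)) y = ∑ i ∈ s, Δ (polyFun (P i)) y := by
  simp only [laplacian_polyFun, map_sum, ← Finset.sum_add_distrib, polyFun, Finset.mul_sum]

theorem toNat_add_mul_toNat_neg_add (n : ℤ) (i : ℕ) :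
    (n.toNat + i) * ((-n).toNat + i) = (n.natAbs + i) * i := by
  rcases le_total 0 n with h | h
  · rw [show (-n).toNat = 0 by omega, show n.toNat = n.natAbs by omega, zero_add]
  · rw [show n.toNat = 0 by omega, show (-n).toNat = n.natAbs by omega, zero_add, mul_comm]

-- The Laplacian lowers either the power of `z z̄` or that of `w w̄`; by the recursion of the
-- coefficients the two contributions to each monomial cancel.
theorem laplacian_harm (d : ℕ) (l m : ℤ) (y : E4) : Δ (harm d l m) y = 0 := by
  have hweight (n : ℤ) (i : ℕ) :
      ((n.toNat + i : ℕ) : ℂ) * ((-n).toNat + i : ℕ) = (n.natAbs + i : ℕ) * (i : ℕ) :=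
    mod_cast toNat_add_mul_toNat_neg_add n i
  rw [← polyFun_harmPoly, harmPoly, laplacian_polyFun_sum]
  simp only [laplacian_polyFun_C_mul_coordMonomial, hweight, mul_add, Finset.sum_add_distrib]
  rw [Finset.sum_range_succ', Finset.sum_range_succ]
  simp only [Nat.cast_zero, mul_zero, zero_mul, add_zero, Nat.sub_self]
  rw [← Finset.sum_add_distrib]
  refine Finset.sum_eq_zero fun i hi => ?_
  obtain ⟨j, rfl⟩ : ∃ j, d = i + 1 + j := ⟨d - (i + 1), by grind⟩
  have hcoeff := congrArg ((↑) : ℝ → ℂ)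
    (jacobiCoeff_succ m.natAbs l.natAbs (show i < i + 1 + j by omega))
  rw [show i + 1 + j - i = j + 1 by omega] at hcoeff ⊢
  rw [show i + 1 + j - (i + 1) = j by omega]
  simp only [← add_assoc, Nat.add_sub_cancel]
  push_cast at hcoeff ⊢
  linear_combination 4 * (-1) ^ j * polyFun (coordMonomial (l.toNat + i) ((-l).toNat + i)
    (m.toNat + j) ((-m).toNat + j)) y * hcoeff

theorem signPow_ofReal_mul (r : ℝ) (z : ℂ) (n : ℤ) :
    signPow (r * z) n = (r : ℂ) ^ n.natAbs * signPow z n := by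
  rw [signPow, signPow, ← Int.toNat_add_toNat_neg_eq_natAbs, map_mul, Complex.conj_ofReal]
  ring

theorem harm_smul (d : ℕ) (l m : ℤ) (r : ℝ) (y : E4) :
    harm d l m (r • y) = (r : ℂ) ^ (l.natAbs + m.natAbs + 2 * d) * harm d l m y := by
  simp only [harm, map_smul, Complex.real_smul, signPow_ofReal_mul, map_mul, Complex.conj_ofReal,
    Finset.mul_sum]
  refine Finset.sum_congr rfl fun i hi => ?_
  have hpow : (r : ℂ) ^ (2 * d) = r ^ (2 * i) * r ^ (2 * (d - i)) := by
    rw [← pow_add]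
    congr 1
    grind
  rw [neg_pow, neg_pow (wCoord y * _)]
  simp only [pow_add, hpow]
  ring

end Polynomial

theorem signPow_neg (z : ℂ) (n : ℤ) : signPow z (-n) = conj (signPow z n) := by
  simp [signPow, mul_comm]

theorem harm_neg (d : ℕ) (l m : ℤ) (y : E4) : harm d (-l) (-m) y = conj (harm d l m y) := by
  simp only [harm, signPow_neg, Int.natAbs_neg, map_mul, map_sum, map_pow, map_neg,
    Complex.conj_conj, Complex.conj_ofReal, mul_comm (conj (zCoord y)), mul_comm (conj (wCoord y))]

theorem signPow_exp_mul (a : ℝ) (z : ℂ) (n : ℤ) :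
    signPow (Complex.exp (a * Complex.I) * z) n =
      Complex.exp ((n * a : ℝ) * Complex.I) * signPow z n := by
  have hn : (n : ℂ) = n.toNat - (-n).toNat := mod_cast (Int.toNat_sub_toNat_neg n).symm
  have hexp : Complex.exp ((n * a : ℝ) * Complex.I) =
      Complex.exp (a * Complex.I) ^ n.toNat * conj (Complex.exp (a * Complex.I)) ^ (-n).toNat := by
    rw [← Complex.exp_conj, ← Complex.exp_nat_mul, ← Complex.exp_nat_mul, ← Complex.exp_add]
    push_cast
    rw [hn, map_mul, Complex.conj_I, Complex.conj_ofReal]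
    ring_nf
  rw [signPow, signPow, map_mul, hexp]
  ring

theorem zCoord_rot (a b : ℝ) (y : E4) :
    zCoord (rot a b y) = Complex.exp (a * Complex.I) * zCoord y := by
  rw [zCoord_apply, zCoord_apply, Complex.exp_mul_I, ← Complex.ofReal_cos, ← Complex.ofReal_sin]
  apply Complex.ext <;> simp [rot]
  ring

theorem wCoord_rot (a b : ℝ) (y : E4) :
    wCoord (rot a b y) = Complex.exp (b * Complex.I) * wCoord y := by
  rw [wCoord_apply, wCoord_apply, Complex.exp_mul_I, ← Complex.ofReal_cos, ← Complex.ofReal_sin]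
  apply Complex.ext <;> simp [rot]
  ring

theorem exp_mul_mul_conj (a : ℝ) (z : ℂ) :
    Complex.exp (a * Complex.I) * z * conj (Complex.exp (a * Complex.I) * z) = z * conj z := by
  rw [Complex.mul_conj, Complex.mul_conj, map_mul, Complex.normSq_eq_norm_sq,
    Complex.norm_exp_ofReal_mul_I, one_pow, one_mul]

theorem harm_rot (d : ℕ) (l m : ℤ) (a b : ℝ) (y : E4) :
    harm d l m (rot a b y) = Complex.exp ((l * a + m * b : ℝ) * Complex.I) * harm d l m y := by
  unfold harm
  rw [zCoord_rot, wCoord_rot, signPow_exp_mul, signPow_exp_mul, exp_mul_mul_conj, exp_mul_mul_conj,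
    Complex.ofReal_add, add_mul, Complex.exp_add]
  ring

/-! ### Orthogonality of the harmonic polynomials -/

theorem continuous_harm (d : ℕ) (l m : ℤ) : Continuous fun x : S3 => harm d l m x :=
  (contDiff_harm d l m (n := 0)).continuous.comp continuous_subtype_val

theorem isSmooth3_clm_harm (Λ : ℂ →L[ℝ] ℝ) (d : ℕ) (l m : ℤ) :
    IsSmooth3 fun x : S3 => Λ (harm d l m x) :=
  isSmooth3_restrict (u := fun y => Λ (harm d l m y)) (Λ.contDiff.comp (contDiff_harm d l m))

theorem sphereLaplacian_clm_harm (Λ : ℂ →L[ℝ] ℝ) (d : ℕ) (l m : ℤ) {k : ℕ}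
    (hk : k = l.natAbs + m.natAbs + 2 * d) (x : S3) :
    sphereLaplacian (fun x : S3 => Λ (harm d l m x)) x =
      -((k : ℝ) * (k + 2)) * Λ (harm d l m x) := by
  have homogeneous (r : ℝ) (y : E4) (_ : 0 < r) :
      Λ (harm d l m (r • y)) = r ^ k * Λ (harm d l m y) := by
    rw [harm_smul, ← hk, ← Complex.ofReal_pow, ← Complex.real_smul, map_smul, smul_eq_mul]
  have harmonic : Δ (fun y => Λ (harm d l m y)) (x : E4) = Λ (Δ (harm d l m) (x : E4)) :=
    (contDiff_harm d l m).contDiffAt.laplacian_CLM_comp_left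
  rw [sphereLaplacian_restrict (u := fun y => Λ (harm d l m y))
    (Λ.contDiff.comp (contDiff_harm d l m)) k homogeneous, harmonic, laplacian_harm, map_zero]
  ring

theorem integral_mul_harm_eq_zero {F : S3 → ℝ} (hF : IsSmooth3 F) {c : ℝ}
    (hc : ∀ x, sphereLaplacian F x = c * F x) (d : ℕ) (l m : ℤ)
    {k : ℕ} (hk : k = l.natAbs + m.natAbs + 2 * d) (hck : c ≠ -((k : ℝ) * (k + 2))) :
    ∫ x : S3, (F x : ℂ) * harm d l m x ∂vol3 = 0 := by
  have hi : Integrable (fun x : S3 => (F x : ℂ) * harm d l m x) vol3 :=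
    integrable_of_continuous ((Complex.continuous_ofReal.comp hF.continuous).mul
      (continuous_harm d l m))
  have clm_eq_zero (Λ : ℂ →L[ℝ] ℝ) : Λ (∫ x : S3, (F x : ℂ) * harm d l m x ∂vol3) = 0 := by
    rw [← Λ.integral_comp_comm hi]
    simpa only [← Complex.real_smul, map_smul, smul_eq_mul] using
      integral_mul_eq_zero_of_eigenvalue_ne hF (isSmooth3_clm_harm Λ d l m) hck hc
        (sphereLaplacian_clm_harm Λ d l m hk)
  exact Complex.ext (clm_eq_zero Complex.reCLM) (clm_eq_zero Complex.imCLM)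

theorem eigenvalue_injective : Function.Injective fun k : ℕ => -((k : ℝ) * (k + 2)) := by
  intro k k' h
  have hprod : ((k : ℝ) - k') * (k + k' + 2) = 0 := by linear_combination -h
  have hpos : (k : ℝ) + k' + 2 ≠ 0 := by positivity
  exact_mod_cast sub_eq_zero.1 ((mul_eq_zero.1 hprod).resolve_right hpos)

theorem integral_harm_mul_harm_of_degree_ne {d d' : ℕ} {l m l' m' : ℤ}
    (h : l.natAbs + m.natAbs + 2 * d ≠ l'.natAbs + m'.natAbs + 2 * d') :
    ∫ x : S3, harm d l m x * harm d' l' m' x ∂vol3 = 0 := by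
  have clm_eq_zero (Λ : ℂ →L[ℝ] ℝ) :
      ∫ x : S3, (Λ (harm d l m x) : ℂ) * harm d' l' m' x ∂vol3 = 0 :=
    integral_mul_harm_eq_zero (isSmooth3_clm_harm Λ d l m)
      (sphereLaplacian_clm_harm Λ d l m rfl) d' l' m' rfl (eigenvalue_injective.ne h)
  have integrable (Λ : ℂ →L[ℝ] ℝ) :
      Integrable (fun x : S3 => (Λ (harm d l m x) : ℂ) * harm d' l' m' x) vol3 :=
    integrable_of_continuous ((Complex.continuous_ofReal.comp
      (Λ.continuous.comp (continuous_harm d l m))).mul (continuous_harm d' l' m'))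
  have re_add_im (x : S3) : harm d l m x * harm d' l' m' x =
      (Complex.reCLM (harm d l m x) : ℂ) * harm d' l' m' x +
        Complex.I * ((Complex.imCLM (harm d l m x) : ℂ) * harm d' l' m' x) := by
    conv_lhs => rw [← Complex.re_add_im (harm d l m x)]
    simp only [Complex.reCLM_apply, Complex.imCLM_apply]
    ring
  simp only [re_add_im]
  rw [integral_add (integrable _) ((integrable _).const_mul _), clm_eq_zero, integral_const_mul,
    clm_eq_zero, mul_zero, add_zero]

theorem exists_exp_weight_ne_one {l m : ℤ} (h : ¬(l = 0 ∧ m = 0)) :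
    ∃ a b : ℝ, Complex.exp ((l * a + m * b : ℝ) * Complex.I) ≠ 1 := by
  have hπ : Complex.exp (Real.pi * Complex.I) ≠ 1 := by
    rw [Complex.exp_pi_mul_I]
    norm_num
  by_cases hl : l = 0
  · have hm : (m : ℝ) ≠ 0 := mod_cast fun hm => h ⟨hl, hm⟩
    exact ⟨0, Real.pi / m, by rwa [mul_div_cancel₀ _ hm, mul_zero, zero_add]⟩
  · have hl : (l : ℝ) ≠ 0 := mod_cast hl
    exact ⟨Real.pi / l, 0, by rwa [mul_div_cancel₀ _ hl, mul_zero, add_zero]⟩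

theorem integral_harm_mul_harm_of_weight_ne {l m l' m' : ℤ} (d d' : ℕ)
    (h : ¬(l + l' = 0 ∧ m + m' = 0)) :
    ∫ x : S3, harm d l m x * harm d' l' m' x ∂vol3 = 0 := by
  obtain ⟨a, b, hab⟩ := exists_exp_weight_ne_one h
  refine integral_eq_zero_of_comp_spherePerm (rot a b) hab fun x => ?_
  change harm d l m (rot a b x) * harm d' l' m' (rot a b x) = _
  have hexp : (((l + l' : ℤ) * a + (m + m' : ℤ) * b : ℝ) : ℂ) * Complex.I =
      (l * a + m * b : ℝ) * Complex.I + (l' * a + m' * b : ℝ) * Complex.I := by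
    push_cast
    ring
  rw [harm_rot, harm_rot, hexp, Complex.exp_add]
  ring

/-! ### Moments -/

/-- The squared distance `x² + y²` to the `(z, w)`-plane. -/
def zSq (y : E4) : ℝ := Complex.normSq (zCoord y)

/-- The squared distance `z² + w²` to the `(x, y)`-plane. -/
def wSq (y : E4) : ℝ := Complex.normSq (wCoord y)

theorem zCoord_mul_conj (y : E4) : zCoord y * conj (zCoord y) = zSq y :=
  Complex.mul_conj _

theorem wCoord_mul_conj (y : E4) : wCoord y * conj (wCoord y) = wSq y :=
  Complex.mul_conj _

theorem wSq_eq_one_sub (x : S3) : wSq x = 1 - zSq x := by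
  have h : ‖(x : E4)‖ ^ 2 = 1 := by simp
  rw [EuclideanSpace.real_norm_sq_eq, Fin.sum_univ_four] at h
  simp only [zSq, wSq, zCoord_apply, wCoord_apply, mul_comm Complex.I, Complex.normSq_add_mul_I]
  linarith

theorem zSq_smul (r : ℝ) (y : E4) : zSq (r • y) = r ^ 2 * zSq y := by
  simp only [zSq, map_smul, Complex.real_smul, map_mul, Complex.normSq_ofReal, pow_two]

theorem zSq_pow_eq_re (n : ℕ) :
    (fun y => zSq y ^ n) = fun y => (polyFun (coordMonomial n n 0 0) y).re := by
  funext y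
  rw [polyFun_coordMonomial, ← mul_pow, zCoord_mul_conj, pow_zero, pow_zero,
    mul_one, mul_one, ← Complex.ofReal_pow, Complex.ofReal_re]

theorem contDiff_zSq_pow (n : ℕ) {k : WithTop ℕ∞} : ContDiff ℝ k fun y => zSq y ^ n := by
  rw [zSq_pow_eq_re]
  exact Complex.reCLM.contDiff.comp (contDiff_polyFun _)

theorem continuous_zSq : Continuous fun x : S3 => zSq x :=
  Complex.continuous_normSq.comp (zCoord.continuous.comp continuous_subtype_val)

theorem continuous_wSq : Continuous fun x : S3 => wSq x :=
  Complex.continuous_normSq.comp (wCoord.continuous.comp continuous_subtype_val)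

theorem laplacian_zSq_pow (n : ℕ) (y : E4) :
    Δ (fun y => zSq y ^ n) y = 4 * n ^ 2 * zSq y ^ (n - 1) := by
  have h := laplacian_polyFun_C_mul_coordMonomial 1 n n 0 0 y
  rw [map_one, one_mul, one_mul] at h
  rw [zSq_pow_eq_re, congrFun (zSq_pow_eq_re (n - 1)) y]
  refine ((contDiff_polyFun _).contDiffAt.laplacian_CLM_comp_left (l := Complex.reCLM)).trans ?_
  rw [Function.comp_apply, h, Complex.reCLM_apply,
    ← Complex.re_ofReal_mul]
  push_cast
  ring_nf

theorem integral_sphereLaplacian {F : S3 → ℝ} (hF : IsSmooth3 F) :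
    ∫ x, sphereLaplacian F x ∂vol3 = 0 := by
  have sphereLaplacian_one (x : S3) : sphereLaplacian (fun _ => 1) x = 0 := by
    rw [sphereLaplacian_restrict (u := fun _ => (1 : ℝ)) contDiff_const 0 (by simp)]
    simp [InnerProductSpace.laplacian_const]
  have h := integral_mul_sphereLaplacian hF (contMDiff_const (c := (1 : ℝ)))
  simpa [sphereLaplacian_one] using h.symm

theorem integral_zSq_pow_succ (n : ℕ) :
    (n + 2) * ∫ x : S3, zSq x ^ (n + 1) ∂vol3 = (n + 1) * ∫ x : S3, zSq x ^ n ∂vol3 := by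
  have laplacian (x : S3) : sphereLaplacian (fun x : S3 => zSq x ^ (n + 1)) x =
      4 * (n + 1) * ((n + 1) * zSq x ^ n - (n + 2) * zSq x ^ (n + 1)) := by
    rw [sphereLaplacian_restrict (u := fun y => zSq y ^ (n + 1)) (contDiff_zSq_pow _)
      (2 * (n + 1)) fun r y _ => by rw [zSq_smul, mul_pow, ← pow_mul], laplacian_zSq_pow]
    push_cast
    ring
  have integrable (n : ℕ) : Integrable (fun x : S3 => zSq x ^ n) vol3 :=
    integrable_of_continuous (continuous_zSq.pow n)
  have h := integral_sphereLaplacian (isSmooth3_restrict (contDiff_zSq_pow (n + 1)))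
  simp only [laplacian] at h
  rw [integral_const_mul, integral_sub ((integrable _).const_mul _) ((integrable _).const_mul _),
    integral_const_mul, integral_const_mul] at h
  have hn : (4 * (n + 1) : ℝ) ≠ 0 := by positivity
  linarith [(mul_eq_zero.1 h).resolve_left hn]

theorem integral_zSq_pow (n : ℕ) : ∫ x : S3, zSq x ^ n ∂vol3 = 2 * Real.pi ^ 2 / (n + 1) := by
  induction n with
  | zero => simp [measureReal_vol3_univ]
  | succ n ih =>
    have h := integral_zSq_pow_succ n
    rw [ih] at h
    push_cast
    rw [eq_div_iff (by positivity)]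
    field_simp at h
    linarith

theorem integrable_zSq_pow_mul_wSq_pow (a b : ℕ) :
    Integrable (fun x : S3 => zSq x ^ a * wSq x ^ b) vol3 :=
  integrable_of_continuous ((continuous_zSq.pow a).mul (continuous_wSq.pow b))

theorem integral_zSq_pow_mul_wSq_pow (a b : ℕ) :
    ∫ x : S3, zSq x ^ a * wSq x ^ b ∂vol3 =
      2 * Real.pi ^ 2 * (a.factorial * b.factorial / (a + b + 1).factorial) := by
  induction b generalizing a with
  | zero =>
    have := a.factorial_ne_zero
    simp only [pow_zero, mul_one, integral_zSq_pow, Nat.factorial_zero, add_zero,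
      Nat.factorial_succ, Nat.cast_one, Nat.cast_mul]
    push_cast
    field_simp
  | succ b ih =>
    have split (x : S3) : zSq x ^ a * wSq x ^ (b + 1) =
        zSq x ^ a * wSq x ^ b - zSq x ^ (a + 1) * wSq x ^ b := by
      rw [pow_succ (wSq _), pow_succ (zSq _)]
      nth_rewrite 2 [wSq_eq_one_sub]
      ring
    simp only [split]
    rw [integral_sub (integrable_zSq_pow_mul_wSq_pow _ _) (integrable_zSq_pow_mul_wSq_pow _ _),
      ih, ih, show a + (b + 1) + 1 = (a + b + 1) + 1 by ring,
      show a + 1 + b + 1 = (a + b + 1) + 1 by ring, Nat.factorial_succ (a + b + 1),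
      Nat.factorial_succ a, Nat.factorial_succ b]
    have := (a + b + 1).factorial_ne_zero
    push_cast
    field_simp
    ring

/-! ### Jacobi polynomials on the unit interval -/

section Jacobi

open Polynomial

/-- The Jacobi polynomial `P_d^{(a, b)}` in the variable `t = (u + 1) / 2`. -/
def jacobiPoly (a b d : ℕ) : ℝ[X] :=
  ∑ i ∈ Finset.range (d + 1), C (jacobiCoeff a b d i) * (X ^ i * (X - C 1) ^ (d - i))

theorem eval_jacobiPoly (a b d : ℕ) (t : ℝ) : (jacobiPoly a b d).eval t =
    ∑ i ∈ Finset.range (d + 1), jacobiCoeff a b d i * (t ^ i * (t - 1) ^ (d - i)) := by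
  simp [jacobiPoly, eval_finsetSum]

theorem monic_X_pow_mul_X_sub_C_pow {R : Type*} [CommRing R] (r : R) (i j : ℕ) :
    (X ^ i * (X - C r) ^ j : R[X]).Monic :=
  (monic_X_pow i).mul ((monic_X_sub_C r).pow j)

theorem natDegree_X_pow_mul_X_sub_C_pow {R : Type*} [CommRing R] [Nontrivial R] (r : R)
    (i j : ℕ) : (X ^ i * (X - C r) ^ j : R[X]).natDegree = i + j := by
  rw [(monic_X_pow i).natDegree_mul ((monic_X_sub_C r).pow j), natDegree_X_pow,
    (monic_X_sub_C r).natDegree_pow, natDegree_X_sub_C, mul_one]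

theorem natDegree_jacobiPoly_le (a b d : ℕ) : (jacobiPoly a b d).natDegree ≤ d := by
  refine natDegree_sum_le_of_forall_le _ _ fun i hi => (natDegree_C_mul_le _ _).trans ?_
  rw [natDegree_X_pow_mul_X_sub_C_pow]
  grind

theorem coeff_jacobiPoly (a b d : ℕ) :
    (jacobiPoly a b d).coeff d = (a + b + 2 * d).choose d := by
  have coeff_term (i : ℕ) (hi : i ∈ Finset.range (d + 1)) :
      (C (jacobiCoeff a b d i) * (X ^ i * (X - C 1) ^ (d - i))).coeff d = jacobiCoeff a b d i := by
    have hmonic := (monic_X_pow_mul_X_sub_C_pow (1 : ℝ) i (d - i)).coeff_natDegree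
    rw [natDegree_X_pow_mul_X_sub_C_pow, show i + (d - i) = d by grind] at hmonic
    rw [coeff_C_mul, hmonic, mul_one]
  rw [jacobiPoly, finsetSum_coeff, Finset.sum_congr rfl coeff_term,
    show a + b + 2 * d = (a + d) + (b + d) by ring, Nat.add_choose_eq,
    Finset.Nat.sum_antidiagonal_eq_sum_range_succ_mk]
  push_cast
  rfl

theorem degree_jacobiPoly (a b d : ℕ) : (jacobiPoly a b d).degree = d := by
  refine degree_eq_of_le_of_coeff_ne_zero
    (degree_le_of_natDegree_le (natDegree_jacobiPoly_le a b d)) ?_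
  rw [coeff_jacobiPoly]
  exact_mod_cast (Nat.choose_pos (by omega)).ne'

theorem degree_jacobiPoly_sub_lt (a b d : ℕ) :
    (jacobiPoly a b d - ((a + b + 2 * d).choose d : ℝ) • X ^ d).degree <
      (d : WithBot ℕ) := by
  have hlead : (jacobiPoly a b d).leadingCoeff = (a + b + 2 * d).choose d := by
    rw [leadingCoeff, natDegree_eq_of_degree_eq_some (degree_jacobiPoly a b d), coeff_jacobiPoly]
  have hchoose : ((a + b + 2 * d).choose d : ℝ) ≠ 0 :=
    mod_cast (Nat.choose_pos (by omega)).ne'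
  rw [smul_eq_C_mul, ← degree_jacobiPoly a b d]
  refine degree_sub_lt_left ?_ (degree_ne_bot.1 (by simp [degree_jacobiPoly])) ?_
  · rw [degree_jacobiPoly, degree_C_mul_X_pow d hchoose]
  · rw [hlead, leadingCoeff_C_mul_X_pow]

/-- The Jacobi polynomials with fixed parameters, one in each degree. -/
def jacobiSequence (a b : ℕ) : Polynomial.Sequence ℝ where
  elems' := jacobiPoly a b
  degree_eq' := degree_jacobiPoly a b

theorem map_eq_zero_of_degree_lt {K A : Type*} [Field K] [AddCommGroup A] [Module K A]
    (S : Polynomial.Sequence K) (Λ : K[X] →ₗ[K] A) {N : ℕ} (h : ∀ j < N, Λ (S j) = 0) {Q : K[X]}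
    (hQ : Q.degree < N) : Λ Q = 0 := by
  have hspan := S.span_degreeLT (m := N) fun i _ =>
    isUnit_iff_ne_zero.2 (leadingCoeff_ne_zero.2 (S.ne_zero i))
  have hle : Submodule.span K (S '' Set.Iio N) ≤ LinearMap.ker Λ := by
    rw [Submodule.span_le]
    rintro _ ⟨j, hj, rfl⟩
    exact h j hj
  exact hle (hspan ▸ mem_degreeLT.2 hQ)

theorem choose_neg_natCast_add_one (n i : ℕ) :
    Ring.choose (-((n : ℤ) + 1)) i = (-1) ^ i * ((n + i).choose i : ℤ) := by
  rw [Ring.choose_neg, show (n : ℤ) + 1 + i - 1 = ((n + i : ℕ) : ℤ) by push_cast; ring,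
    Ring.choose_natCast]
  simp [Int.negOnePow_def, Units.smul_def]

-- The Chu-Vandermonde identity for `choose (-(L + 1) + L) d = (-1) ^ d`.
theorem alternating_choose_sum (L d : ℕ) :
    ∑ i ∈ Finset.range (d + 1), (-1 : ℤ) ^ (d - i) * L.choose (d - i) * (L + i).choose i = 1 := by
  have vandermonde := Ring.add_choose_eq (r := -((L : ℤ) + 1)) (s := (L : ℤ)) d (Commute.all _ _)
  have choose_neg_one : Ring.choose (-1 : ℤ) d = (-1) ^ d := by
    simpa using choose_neg_natCast_add_one 0 d
  rw [Finset.Nat.sum_antidiagonal_eq_sum_range_succ_mk, show -((L : ℤ) + 1) + L = -1 by ring,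
    choose_neg_one] at vandermonde
  have hsign : ((-1 : ℤ) ^ d) * (-1) ^ d = 1 := by rw [← mul_pow]; simp
  refine Eq.trans ?_ ((congrArg ((-1) ^ d * ·) vandermonde.symm).trans hsign)
  rw [Finset.mul_sum]
  refine Finset.sum_congr rfl fun i hi => ?_
  have hpow : (-1 : ℤ) ^ d * (-1) ^ i = (-1) ^ (d - i) := by
    obtain ⟨j, rfl⟩ := Nat.exists_eq_add_of_le (Finset.mem_range_succ_iff.1 hi)
    rw [Nat.add_sub_cancel_left, pow_add, mul_right_comm, ← mul_pow]
    simp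
  rw [choose_neg_natCast_add_one, Ring.choose_natCast]
  linear_combination -((L + i).choose i : ℤ) * (L.choose (d - i) : ℤ) * hpow

theorem sum_jacobiCoeff_mul_factorial (a b d : ℕ) :
    ∑ i ∈ Finset.range (d + 1), jacobiCoeff a b d i * (-1) ^ (d - i) *
      ((b + d + i).factorial * (a + (d - i)).factorial) =
        ((a + d).factorial : ℝ) * (b + d).factorial := by
  have alternating : ∑ i ∈ Finset.range (d + 1), (-1 : ℝ) ^ (d - i) * (b + d).choose (d - i) *
      (b + d + i).choose i = 1 := mod_cast alternating_choose_sum (b + d) d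
  refine Eq.trans ?_ ((congrArg (((a + d).factorial : ℝ) * (b + d).factorial * ·)
    alternating).trans (mul_one _))
  rw [Finset.mul_sum]
  refine Finset.sum_congr rfl fun i hi => ?_
  have hi' : i ≤ d := Finset.mem_range_succ_iff.1 hi
  have h1 : ((a + d).choose i : ℝ) * i.factorial * (a + (d - i)).factorial = (a + d).factorial := by
    have := Nat.choose_mul_factorial_mul_factorial (show i ≤ a + d by omega)
    rw [show a + d - i = a + (d - i) by omega] at this
    exact_mod_cast this
  have h2 : ((b + d + i).choose i : ℝ) * i.factorial * (b + d).factorial =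
      (b + d + i).factorial := by
    have := Nat.choose_mul_factorial_mul_factorial (show i ≤ b + d + i by omega)
    rw [show b + d + i - i = b + d by omega] at this
    exact_mod_cast this
  unfold jacobiCoeff
  rw [← h1, ← h2]
  ring

/-! ### The norm of the harmonic polynomials -/

/-- Integration over the sphere of polynomials in `zSq` against a continuous function. -/
def polyIntegral {A : Type*} [NormedAddCommGroup A] [NormedSpace ℝ A] (G : C(S3, A)) :
    ℝ[X] →ₗ[ℝ] A where
  toFun Q := ∫ x : S3, Q.eval (zSq x) • G x ∂vol3
  map_add' P Q := by
    have integrable (Q : ℝ[X]) : Integrable (fun x : S3 => Q.eval (zSq x) • G x) vol3 :=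
      integrable_of_continuous ((Q.continuous.comp continuous_zSq).smul G.continuous)
    simp only [eval_add, add_smul, integral_add (integrable P) (integrable Q)]
  map_smul' r Q := by
    simp only [eval_smul, smul_assoc, integral_smul, RingHom.id_apply]

/-- The weight on the sphere for which the polynomials `P_d^{(a, b)}` in `zSq` are orthogonal. -/
def jacobiWeight (a b : ℕ) : C(S3, ℝ) :=
  ⟨fun x => zSq x ^ b * wSq x ^ a, (continuous_zSq.pow b).mul (continuous_wSq.pow a)⟩

theorem polyIntegral_jacobiWeight_X_pow_mul (a b i j : ℕ) :
    polyIntegral (jacobiWeight a b) (X ^ i * (X - C 1) ^ j) = 2 * Real.pi ^ 2 *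
      ((-1) ^ j * ((b + i).factorial * (a + j).factorial) / (a + b + i + j + 1).factorial) := by
  have integrand (x : S3) : (X ^ i * (X - C 1) ^ j : ℝ[X]).eval (zSq x) • jacobiWeight a b x =
      (-1) ^ j * (zSq x ^ (b + i) * wSq x ^ (a + j)) := by
    simp only [eval_mul, eval_pow, eval_X, eval_sub, eval_C, ← neg_sub 1 (zSq x),
      ← wSq_eq_one_sub, neg_pow (wSq x), jacobiWeight, ContinuousMap.coe_mk, smul_eq_mul]
    ring
  calc polyIntegral (jacobiWeight a b) (X ^ i * (X - C 1) ^ j)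
      = ∫ x : S3, (-1) ^ j * (zSq x ^ (b + i) * wSq x ^ (a + j)) ∂vol3 :=
        integral_congr_ae (.of_forall integrand)
    _ = _ := by
        rw [integral_const_mul, integral_zSq_pow_mul_wSq_pow,
          show b + i + (a + j) + 1 = a + b + i + j + 1 by ring]
        ring

theorem polyIntegral_jacobiPoly_mul_X_pow (a b d : ℕ) :
    polyIntegral (jacobiWeight a b) (jacobiPoly a b d * X ^ d) = 2 * Real.pi ^ 2 *
      ((a + d).factorial * (b + d).factorial / (a + b + 2 * d + 1).factorial) := by
  have expand : jacobiPoly a b d * X ^ d = ∑ i ∈ Finset.range (d + 1),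
      jacobiCoeff a b d i • (X ^ (d + i) * (X - C 1) ^ (d - i)) := by
    rw [jacobiPoly, Finset.sum_mul]
    refine Finset.sum_congr rfl fun i _ => ?_
    rw [smul_eq_C_mul]
    ring
  rw [expand, map_sum, ← sum_jacobiCoeff_mul_factorial, Finset.sum_div, Finset.mul_sum]
  refine Finset.sum_congr rfl fun i hi => ?_
  rw [map_smul, polyIntegral_jacobiWeight_X_pow_mul, smul_eq_mul,
    show a + b + (d + i) + (d - i) + 1 = a + b + 2 * d + 1 by grind, ← add_assoc b]
  ring

theorem signPow_mul_signPow_neg (z : ℂ) (n : ℤ) :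
    signPow z n * signPow z (-n) = (z * conj z) ^ n.natAbs := by
  rw [signPow, signPow, neg_neg, ← Int.toNat_add_toNat_neg_eq_natAbs]
  ring

theorem harm_coe (d : ℕ) (l m : ℤ) (x : S3) : harm d l m x =
    signPow (zCoord x) l * signPow (wCoord x) m *
      (((jacobiPoly m.natAbs l.natAbs d).eval (zSq x) : ℝ) : ℂ) := by
  rw [harm, eval_jacobiPoly, zCoord_mul_conj, wCoord_mul_conj, wSq_eq_one_sub]
  push_cast
  simp only [neg_sub, mul_assoc]

theorem integral_harm_mul_harm_neg_eq (d d' : ℕ) (l m : ℤ) :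
    ∫ x : S3, harm d l m x * harm d' (-l) (-m) x ∂vol3 =
      polyIntegral (jacobiWeight m.natAbs l.natAbs)
        (jacobiPoly m.natAbs l.natAbs d * jacobiPoly m.natAbs l.natAbs d') := by
  refine (integral_congr_ae (.of_forall fun x => ?_)).trans integral_complex_ofReal
  have hz := signPow_mul_signPow_neg (zCoord x) l
  have hw := signPow_mul_signPow_neg (wCoord x) m
  rw [zCoord_mul_conj] at hz
  rw [wCoord_mul_conj] at hw
  simp only [harm_coe, Int.natAbs_neg, eval_mul, jacobiWeight, ContinuousMap.coe_mk, smul_eq_mul]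
  push_cast
  rw [← hz, ← hw]
  ring

theorem polyIntegral_jacobiPoly_mul_eq_zero (a b d : ℕ) {Q : ℝ[X]} (hQ : Q.degree < d) :
    polyIntegral (jacobiWeight a b) (jacobiPoly a b d * Q) = 0 := by
  refine map_eq_zero_of_degree_lt (jacobiSequence a b)
    (polyIntegral (jacobiWeight a b) ∘ₗ LinearMap.mulLeft ℝ (jacobiPoly a b d)) (fun j hj => ?_) hQ
  have h := integral_harm_mul_harm_of_degree_ne (d := d) (d' := j) (l := b) (m := a)
    (l' := -b) (m' := -a) (by simp; omega)
  rw [integral_harm_mul_harm_neg_eq] at h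
  exact_mod_cast h

/-- The squared norm of `harm d l m` in `L²` of the sphere, where `a = |m|` and `b = |l|`. -/
def harmNormSq (a b d : ℕ) : ℝ :=
  2 * Real.pi ^ 2 * (((b + d).factorial * (a + d).factorial : ℝ) /
    ((a + b + 2 * d + 1) * d.factorial * (b + a + d).factorial))

theorem polyIntegral_jacobiPoly_sq (a b d : ℕ) :
    polyIntegral (jacobiWeight a b) (jacobiPoly a b d * jacobiPoly a b d) = harmNormSq a b d := by
  set c := ((a + b + 2 * d).choose d : ℝ) with hc
  have hlead := polyIntegral_jacobiPoly_mul_eq_zero a b d (degree_jacobiPoly_sub_lt a b d)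
  rw [mul_sub, map_sub, sub_eq_zero, mul_smul_comm, map_smul, smul_eq_mul, ← hc] at hlead
  have hchoose : c * d.factorial * (b + a + d).factorial = (a + b + 2 * d).factorial := by
    have := Nat.choose_mul_factorial_mul_factorial (show d ≤ a + b + 2 * d by omega)
    rw [show a + b + 2 * d - d = b + a + d by omega] at this
    rw [hc]
    exact_mod_cast this
  have hc0 : c ≠ 0 := Nat.cast_ne_zero.2 (Nat.choose_pos (by omega)).ne'
  have := d.factorial_ne_zero
  have := (b + a + d).factorial_ne_zero
  rw [hlead, polyIntegral_jacobiPoly_mul_X_pow, harmNormSq, Nat.factorial_succ]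
  push_cast
  rw [← hchoose]
  field_simp

theorem integral_harm_mul_harm_neg (d : ℕ) (l m : ℤ) :
    ∫ x : S3, harm d l m x * harm d (-l) (-m) x ∂vol3 = harmNormSq m.natAbs l.natAbs d := by
  rw [integral_harm_mul_harm_neg_eq, polyIntegral_jacobiPoly_sq]

end Jacobi

/-! ### Completeness of the harmonic polynomials -/

theorem continuous_signPow (n : ℤ) : Continuous fun z : ℂ => signPow z n :=
  (continuous_id.pow _).mul (Complex.continuous_conj.pow _)

theorem pow_mul_conj_pow (z : ℂ) (a b : ℕ) :
    z ^ a * conj z ^ b = signPow z ((a : ℤ) - b) * (z * conj z) ^ min a b := by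
  have ha : a = ((a : ℤ) - b).toNat + min a b := by omega
  have hb : b = (-((a : ℤ) - b)).toNat + min a b := by omega
  rw [signPow, mul_pow, mul_mul_mul_comm, ← pow_add, ← pow_add, ← ha, ← hb]

open Polynomial in
theorem integral_mul_coordMonomial_eq_zero {F : C(S3, ℂ)}
    (h : ∀ d l m, ∫ x : S3, F x * harm d l m x ∂vol3 = 0) (a b c e : ℕ) :
    ∫ x : S3, F x * polyFun (coordMonomial a b c e) x ∂vol3 = 0 := by
  set l : ℤ := (a : ℤ) - b
  set m : ℤ := (c : ℤ) - e
  let G : C(S3, ℂ) := F * ⟨fun x => signPow (zCoord x) l * signPow (wCoord x) m,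
    ((continuous_signPow l).comp (zCoord.continuous.comp continuous_subtype_val)).mul
      ((continuous_signPow m).comp (wCoord.continuous.comp continuous_subtype_val))⟩
  have integral_jacobiPoly (d : ℕ) : polyIntegral G (jacobiPoly m.natAbs l.natAbs d) = 0 := by
    refine (integral_congr_ae (.of_forall fun x => ?_)).trans (h d l m)
    simp only [G, harm_coe, ContinuousMap.mul_apply, ContinuousMap.coe_mk, Complex.real_smul]
    ring
  let Q : ℝ[X] := X ^ min a b * (1 - X) ^ min c e
  have integral_Q : polyIntegral G Q = 0 :=
    map_eq_zero_of_degree_lt (jacobiSequence m.natAbs l.natAbs) _ (fun d _ => integral_jacobiPoly d)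
      (degree_le_natDegree.trans_lt (mod_cast Nat.lt_succ_self Q.natDegree))
  refine (integral_congr_ae (.of_forall fun x => ?_)).trans integral_Q
  simp only [polyFun_coordMonomial, pow_mul_conj_pow, zCoord_mul_conj, wCoord_mul_conj,
    wSq_eq_one_sub, Q, G, eval_mul, eval_pow, eval_X, eval_sub, eval_one, ContinuousMap.mul_apply,
    ContinuousMap.coe_mk, Complex.real_smul]
  push_cast
  ring

theorem integral_mul_polyFun_eq_zero {F : C(S3, ℂ)}
    (h : ∀ d l m, ∫ x : S3, F x * harm d l m x ∂vol3 = 0) (P : MvPolynomial (Fin 4) ℂ) :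
    ∫ x : S3, F x * polyFun P x ∂vol3 = 0 := by
  have expand (x : S3) : F x * polyFun P x = ∑ s ∈ P.support,
      P.coeff s * (F x * polyFun (coordMonomial (s 0) (s 1) (s 2) (s 3)) x) := by
    rw [polyFun, MvPolynomial.eval_eq', Finset.mul_sum]
    refine Finset.sum_congr rfl fun s _ => ?_
    simp only [polyFun, coordMonomial, Fin.prod_univ_four, map_mul, map_pow, MvPolynomial.eval_X]
    ring
  have integrable (P : MvPolynomial (Fin 4) ℂ) (r : ℂ) :
      Integrable (fun x : S3 => r * (F x * polyFun P x)) vol3 :=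
    (integrable_of_continuous (F.continuous.mul ((contDiff_polyFun P (n := 0)).continuous.comp
      continuous_subtype_val))).const_mul r
  simp only [expand]
  rw [integral_finsetSum _ fun s _ => integrable _ _]
  exact Finset.sum_eq_zero fun s _ => by
    rw [integral_const_mul, integral_mul_coordMonomial_eq_zero h, mul_zero]

theorem eq_zero_of_integral_mul_star_eq_zero {X : Type*} [TopologicalSpace X] [CompactSpace X]
    [MeasurableSpace X] [BorelSpace X] {μ : Measure X} [IsFiniteMeasure μ] [μ.IsOpenPosMeasure]
    {A : StarSubalgebra ℂ C(X, ℂ)} (hA : A.SeparatesPoints) {f : C(X, ℂ)}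
    (h : ∀ g ∈ A, ∫ x, g x * conj (f x) ∂μ = 0) : f = 0 := by
  let J : C(X, ℂ) →L[ℂ] Lp ℂ 2 μ := ContinuousMap.toLp 2 μ ℂ
  have orthogonal (g : C(X, ℂ)) : inner ℂ (J f) (J g) = 0 := by
    have hg : g ∈ A.topologicalClosure :=
      ContinuousMap.starSubalgebra_topologicalClosure_eq_top_of_separatesPoints A hA ▸ trivial
    refine closure_minimal (fun g hg => ?_)
      (isClosed_singleton.preimage ((innerSL ℂ (J f)).comp J).continuous) hg
    exact (ContinuousMap.inner_toLp μ f g).trans (h g hg)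
  exact (ContinuousMap.toLp_injective μ) ((inner_self_eq_zero.1 (orthogonal f)).trans
    (map_zero _).symm)

/-- The restriction of a linear form to the sphere. -/
def sphereForm (L : E4 →L[ℝ] ℂ) : C(S3, ℂ) :=
  ⟨fun x => L x, L.continuous.comp continuous_subtype_val⟩

theorem separatesPoints_adjoin_sphereForm :
    (StarAlgebra.adjoin ℂ {sphereForm zCoord, sphereForm wCoord}).SeparatesPoints := by
  intro x y hxy
  contrapose! hxy
  have hz : zCoord x = zCoord y := hxy _ ⟨_, StarAlgebra.subset_adjoin _ _ (.inl rfl), rfl⟩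
  have hw : wCoord x = wCoord y := hxy _ ⟨_, StarAlgebra.subset_adjoin _ _ (.inr rfl), rfl⟩
  rw [zCoord_apply, zCoord_apply, Complex.ext_iff] at hz
  rw [wCoord_apply, wCoord_apply, Complex.ext_iff] at hw
  ext i
  fin_cases i
  · simpa using hz.1
  · simpa using hz.2
  · simpa using hw.1
  · simpa using hw.2

theorem exists_polyFun_of_mem_adjoin {g : C(S3, ℂ)}
    (hg : g ∈ StarAlgebra.adjoin ℂ {sphereForm zCoord, sphereForm wCoord}) :
    ∃ P, ∀ x : S3, g x = polyFun P x := by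
  have generators : ({sphereForm zCoord, sphereForm wCoord} ∪
      star {sphereForm zCoord, sphereForm wCoord} : Set C(S3, ℂ)) ⊆
        Set.range fun j => sphereForm (complexCoord j) := by
    rintro g ((rfl | rfl) | h | h)
    · exact ⟨0, rfl⟩
    · exact ⟨2, rfl⟩
    · exact ⟨1, by rw [← star_star g, h]; rfl⟩
    · exact ⟨3, by rw [← star_star g, h]; rfl⟩
  have hmem := Algebra.adjoin_mono generators hg
  rw [Algebra.adjoin_range_eq_range_aeval] at hmem
  obtain ⟨P, rfl⟩ := hmem
  refine ⟨P, fun x => ?_⟩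
  rw [polyFun, ← MvPolynomial.coe_aeval_eq_eval]
  exact MvPolynomial.comp_aeval_apply _ (ContinuousMap.evalAlgHom ℂ ℂ x) P

theorem eq_zero_of_integral_mul_harm_eq_zero {f : S3 → ℝ} (hf : Continuous f)
    (h : ∀ d l m, ∫ x : S3, (f x : ℂ) * harm d l m x ∂vol3 = 0) : f = 0 := by
  let F : C(S3, ℂ) := ⟨fun x => (f x : ℂ), Complex.continuous_ofReal.comp hf⟩
  have hF : F = 0 := by
    refine eq_zero_of_integral_mul_star_eq_zero (μ := vol3) separatesPoints_adjoin_sphereForm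
      fun g hg => ?_
    obtain ⟨P, hP⟩ := exists_polyFun_of_mem_adjoin hg
    refine (integral_congr_ae (.of_forall fun x => ?_)).trans
      (integral_mul_polyFun_eq_zero (F := F) h P)
    simp only [hP, F, ContinuousMap.coe_mk, Complex.conj_ofReal, mul_comm]
  funext x
  exact Complex.ofReal_eq_zero.1 (DFunLike.congr_fun hF x)

/-! ### Normalized real harmonic polynomials -/

/-- The factor `u` for which `re (u z)` is the real part (`false`) or the imaginary part (`true`)
of `z`. -/
def phase (s : Bool) : ℂ := cond s (-Complex.I) 1

theorem re_phase_mul_conj_phase (s t : Bool) :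
    (phase s * conj (phase t)).re = if s = t then 1 else 0 := by
  cases s <;> cases t <;> simp [phase]

theorem re_phase_mul_exp (s : Bool) (t : ℝ) :
    (phase s * Complex.exp (t * Complex.I)).re = cond s (Real.sin t) (Real.cos t) := by
  cases s <;> simp [phase, Complex.exp_ofReal_mul_I_re, Complex.exp_ofReal_mul_I_im]

theorem eq_zero_of_re_phase_mul_eq_zero {z : ℂ} (h : ∀ s, (phase s * z).re = 0) : z = 0 :=
  Complex.ext (by simpa [phase] using h false) (by simpa [phase] using h true)

theorem integral_re_mul_re {X : Type*} [MeasurableSpace X] {μ : Measure X} {F G : X → ℂ}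
    (h : Integrable (fun x => F x * conj (G x)) μ) (h' : Integrable (fun x => F x * G x) μ) :
    ∫ x, (F x).re * (G x).re ∂μ = (∫ x, F x * conj (G x) ∂μ + ∫ x, F x * G x ∂μ).re / 2 := by
  rw [← integral_add h h']
  refine Eq.trans ?_ (congrArg (· / 2) (Complex.reCLM.integral_comp_comm (h.add h')))
  rw [← integral_div]
  refine integral_congr_ae (.of_forall fun x => ?_)
  simp only [Complex.reCLM_apply, Complex.add_re, Complex.mul_re, Complex.conj_re,
    Complex.conj_im]
  ring

theorem integral_re_phase_mul_harm (s t : Bool) (d d' : ℕ) (l m l' m' : ℤ) :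
    ∫ x : S3, (phase s * harm d l m x).re * (phase t * harm d' l' m' x).re ∂vol3 =
      (phase s * conj (phase t) * ∫ x : S3, harm d l m x * harm d' (-l') (-m') x ∂vol3 +
        phase s * phase t * ∫ x : S3, harm d l m x * harm d' l' m' x ∂vol3).re / 2 := by
  have hF := (continuous_harm d l m).const_mul (phase s)
  have hG := (continuous_harm d' l' m').const_mul (phase t)
  rw [integral_re_mul_re (integrable_of_continuous (hF.mul (Complex.continuous_conj.comp hG)))
    (integrable_of_continuous (hF.mul hG))]
  simp only [map_mul, harm_neg, ← integral_const_mul, mul_assoc, mul_left_comm]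

/-- The indices `s, l, m` of the real harmonics `re (phase s * harm d l m)`: since the indices
`l, m` and `-l, -m` give conjugate functions, a half plane suffices, and at its corner `harm` is
real. -/
def IsHalf (s : Bool) (l m : ℤ) : Prop := 0 < l ∨ l = 0 ∧ (0 < m ∨ m = 0 ∧ s = false)

/-- The constant that normalizes the real and imaginary parts of `harm (deg k l m) l m`. -/
def normFactor (k : ℕ) (l m : ℤ) : ℝ := (if l = 0 ∨ m = 0 then 1 else √(1 / 2)) / psiNorm k l m

/-- The normalized real or imaginary part of the harmonic polynomial of degree `k`. -/
def realHarm (s : Bool) (k : ℕ) (l m : ℤ) (x : S3) : ℝ :=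
  normFactor k l m * (phase s * harm (deg k l m) l m x).re

theorem integral_realHarm_mul_realHarm (s t : Bool) (k : ℕ) (l m l' m' : ℤ) :
    ∫ x, realHarm s k l m x * realHarm t k l' m' x ∂vol3 = normFactor k l m * normFactor k l' m' *
      ∫ x : S3, (phase s * harm (deg k l m) l m x).re * (phase t * harm (deg k l' m') l' m' x).re
        ∂vol3 := by
  simp only [realHarm, mul_mul_mul_comm (normFactor k l m), integral_const_mul]

theorem integral_realHarm_eq_zero {s t : Bool} (k : ℕ) {l m l' m' : ℤ} (h : IsHalf s l m)
    (h' : IsHalf t l' m') (hne : ¬(s = t ∧ l = l' ∧ m = m')) :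
    ∫ x, realHarm s k l m x * realHarm t k l' m' x ∂vol3 = 0 := by
  unfold IsHalf at h h'
  have hsum : ¬(l + l' = 0 ∧ m + m' = 0) := by grind
  rw [integral_realHarm_mul_realHarm, integral_re_phase_mul_harm,
    integral_harm_mul_harm_of_weight_ne _ _ hsum]
  by_cases hlm : l = l' ∧ m = m'
  · obtain ⟨rfl, rfl⟩ := hlm
    rw [integral_harm_mul_harm_neg, mul_zero, add_zero, Complex.re_mul_ofReal,
      re_phase_mul_conj_phase, if_neg (by tauto)]
    ring
  · rw [integral_harm_mul_harm_of_weight_ne _ _ (by omega)]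
    simp

theorem Admissible.degree_eq {k : ℕ} {l m : ℤ} (h : Admissible k l m) :
    k = l.natAbs + m.natAbs + 2 * deg k l m := by
  obtain ⟨h1, h2⟩ := h
  rw [Int.abs_eq_natAbs, Int.abs_eq_natAbs] at h1
  rw [Int.ModEq] at h2
  unfold deg
  omega

theorem harmNormSq_pos (a b d : ℕ) : 0 < harmNormSq a b d := by
  unfold harmNormSq
  positivity

theorem psiNorm_sq {k : ℕ} {l m : ℤ} (h : Admissible k l m) : psiNorm k l m ^ 2 =
    2 ^ ((if l = 0 then 1 else 0) + (if m = 0 then 1 else 0) : ℕ) *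
      harmNormSq m.natAbs l.natAbs (deg k l m) / 4 := by
  have hk : (k : ℝ) = l.natAbs + m.natAbs + 2 * deg k l m := mod_cast h.degree_eq
  have := (deg k l m).factorial_ne_zero
  have := (l.natAbs + m.natAbs + deg k l m).factorial_ne_zero
  rw [psiNorm, mul_pow, mul_pow, Real.sq_sqrt (by positivity), Real.sq_sqrt (by positivity), hk,
    harmNormSq]
  field_simp
  ring

theorem psiNorm_pos (k : ℕ) (l m : ℤ) : 0 < psiNorm k l m := by
  unfold psiNorm
  positivity

theorem normFactor_pos (k : ℕ) (l m : ℤ) : 0 < normFactor k l m := by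
  have := psiNorm_pos k l m
  unfold normFactor
  split_ifs <;> positivity

theorem normFactor_sq_mul_harmNormSq {k : ℕ} {l m : ℤ} (h : Admissible k l m) :
    normFactor k l m ^ 2 * harmNormSq m.natAbs l.natAbs (deg k l m) =
      if l = 0 ∧ m = 0 then 1 else 2 := by
  have hN := (harmNormSq_pos m.natAbs l.natAbs (deg k l m)).ne'
  rw [normFactor, div_pow, psiNorm_sq h]
  generalize harmNormSq m.natAbs l.natAbs (deg k l m) = N at hN
  by_cases hl : l = 0 <;> by_cases hm : m = 0 <;> simp [hl, hm] <;> field_simp <;> norm_num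

theorem integral_realHarm_sq {s : Bool} {k : ℕ} {l m : ℤ} (h : Admissible k l m)
    (hs : IsHalf s l m) : ∫ x, realHarm s k l m x * realHarm s k l m x ∂vol3 = 1 := by
  have hN := normFactor_sq_mul_harmNormSq h
  rw [integral_realHarm_mul_realHarm, integral_re_phase_mul_harm, integral_harm_mul_harm_neg,
    Complex.add_re, Complex.re_mul_ofReal, re_phase_mul_conj_phase, if_pos rfl]
  by_cases h0 : l = 0 ∧ m = 0
  · obtain ⟨rfl, rfl⟩ := h0
    obtain rfl : s = false := by simpa [IsHalf] using hs
    have hsq := integral_harm_mul_harm_neg (deg k 0 0) 0 0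
    rw [neg_zero] at hsq
    rw [hsq]
    simp [phase] at hN ⊢
    linear_combination hN
  · rw [integral_harm_mul_harm_of_weight_ne _ _ (by omega), mul_zero, Complex.zero_re]
    rw [if_neg h0] at hN
    linear_combination hN / 2

theorem isSmooth3_realHarm (s : Bool) (k : ℕ) (l m : ℤ) : IsSmooth3 (realHarm s k l m) :=
  isSmooth3_clm_harm (normFactor k l m • Complex.reCLM ∘L ContinuousLinearMap.mul ℝ ℂ (phase s))
    (deg k l m) l m

theorem sphereLaplacian_realHarm (s : Bool) {k : ℕ} {l m : ℤ} (h : Admissible k l m) (x : S3) :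
    sphereLaplacian (realHarm s k l m) x = -((k : ℝ) * (k + 2)) * realHarm s k l m x :=
  sphereLaplacian_clm_harm
    (normFactor k l m • Complex.reCLM ∘L ContinuousLinearMap.mul ℝ ℂ (phase s))
    (deg k l m) l m h.degree_eq x

/-! ### Modes in toroidal coordinates -/

theorem jacobi_two_mul_sub_one (a b d : ℕ) (t : ℝ) :
    jacobi a b d (2 * t - 1) = (jacobiPoly a b d).eval t := by
  rw [jacobi, eval_jacobiPoly, Finset.mul_sum]
  refine Finset.sum_congr rfl fun i hi => ?_
  rw [show 2 * t - 1 + 1 = 2 * t by ring, show 2 * t - 1 - 1 = 2 * (t - 1) by ring, mul_pow,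
    mul_pow, jacobiCoeff, ← pow_mul_pow_sub (2 : ℝ) (Finset.mem_range_succ_iff.1 hi)]
  field_simp

/-- The dependence of `Ψ_{kℓm}` on the coordinate `χ`. -/
def psiRadial (k : ℕ) (l m : ℤ) (χ : ℝ) : ℝ :=
  Real.cos χ ^ l.natAbs * Real.sin χ ^ m.natAbs *
    jacobi m.natAbs l.natAbs (deg k l m) (Real.cos (2 * χ)) / psiNorm k l m

theorem psi_eq (k : ℕ) (l m : ℤ) (χ θ φ : ℝ) :
    psi k l m χ θ φ = psiRadial k l m χ * (circ l θ * circ m φ) := by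
  rw [psi, psiTilde, psiRadial]
  ring

theorem psiRadial_neg_left (k : ℕ) (l m : ℤ) : psiRadial k (-l) m = psiRadial k l m := by
  simp [funext_iff, psiRadial, psiNorm, deg]

theorem psiRadial_neg_right (k : ℕ) (l m : ℤ) : psiRadial k l (-m) = psiRadial k l m := by
  simp [funext_iff, psiRadial, psiNorm, deg]

theorem psiRadial_abs_left (k : ℕ) (l m : ℤ) : psiRadial k |l| m = psiRadial k l m := by
  rcases abs_choice l with h | h <;> rw [h]
  exact psiRadial_neg_left k l m

theorem psiRadial_abs_right (k : ℕ) (l m : ℤ) : psiRadial k l |m| = psiRadial k l m := by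
  rcases abs_choice m with h | h <;> rw [h]
  exact psiRadial_neg_right k l m

theorem zCoord_toroidal (χ θ φ : ℝ) :
    zCoord (toroidal χ θ φ) = Complex.exp (θ * Complex.I) * (Real.cos χ : ℝ) := by
  rw [zCoord_apply, Complex.exp_mul_I, ← Complex.ofReal_cos, ← Complex.ofReal_sin]
  simp only [toroidal]
  simp
  ring

theorem wCoord_toroidal (χ θ φ : ℝ) :
    wCoord (toroidal χ θ φ) = Complex.exp (φ * Complex.I) * (Real.sin χ : ℝ) := by
  rw [wCoord_apply, Complex.exp_mul_I, ← Complex.ofReal_cos, ← Complex.ofReal_sin]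
  simp [toroidal]
  ring

theorem zSq_toroidal (χ θ φ : ℝ) : zSq (toroidal χ θ φ) = Real.cos χ ^ 2 := by
  rw [zSq, zCoord_toroidal, map_mul, Complex.normSq_eq_norm_sq, Complex.norm_exp_ofReal_mul_I,
    Complex.normSq_ofReal]
  ring

theorem signPow_one (n : ℤ) : signPow 1 n = 1 := by simp [signPow]

theorem harm_toroidal (k : ℕ) (l m : ℤ) (χ θ φ : ℝ) : harm (deg k l m) l m (toroidal χ θ φ) =
    (psiNorm k l m * psiRadial k l m χ : ℝ) *
      Complex.exp ((l * θ + m * φ : ℝ) * Complex.I) := by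
  have signPow_coe (r : ℝ) (n : ℤ) : signPow (r : ℂ) n = (r : ℂ) ^ n.natAbs := by
    simpa [signPow_one] using signPow_ofReal_mul r 1 n
  rw [harm_coe, zCoord_toroidal, wCoord_toroidal, zSq_toroidal, signPow_exp_mul, signPow_exp_mul,
    signPow_coe, signPow_coe, ← jacobi_two_mul_sub_one, ← Real.cos_two_mul, psiRadial,
    mul_div_cancel₀ _ (psiNorm_pos k l m).ne', Complex.ofReal_add, add_mul, Complex.exp_add]
  push_cast
  ring

theorem realHarm_toroidal (s : Bool) (k : ℕ) (l m : ℤ) (χ θ φ : ℝ) :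
    realHarm s k l m (toroidal χ θ φ) = (if l = 0 ∨ m = 0 then 1 else √(1 / 2)) *
      (psiRadial k l m χ * cond s (Real.sin (l * θ + m * φ)) (Real.cos (l * θ + m * φ))) := by
  have := (psiNorm_pos k l m).ne'
  rw [realHarm, harm_toroidal, mul_left_comm, Complex.re_ofReal_mul, re_phase_mul_exp, normFactor]
  field_simp

theorem circ_eq (n : ℤ) (t : ℝ) :
    circ n t = cond (decide (n < 0)) (Real.sin (|n| * t)) (Real.cos (|n| * t)) := by
  rw [circ, Nat.cast_natAbs]
  rcases le_or_gt 0 n with h | h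
  · simp [h, h.not_gt]
  · simp [h, h.not_ge]

theorem circ_of_pos {n : ℤ} (hn : 0 < n) (t : ℝ) : circ n t = Real.cos (n * t) := by
  simp [circ_eq, hn.not_gt, abs_of_pos (Int.cast_pos.2 hn)]

theorem circ_neg_of_pos {n : ℤ} (hn : 0 < n) (t : ℝ) : circ (-n) t = Real.sin (n * t) := by
  simp [circ_eq, hn, abs_of_pos (Int.cast_pos.2 hn)]

theorem circ_zero (t : ℝ) : circ 0 t = 1 := by simp [circ]

theorem admissible_of_degree_eq {k d : ℕ} {l m : ℤ} (h : k = l.natAbs + m.natAbs + 2 * d) :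
    Admissible k l m := by
  refine ⟨by rw [Int.abs_eq_natAbs, Int.abs_eq_natAbs]; omega, ?_⟩
  rw [Int.ModEq]
  omega

theorem Admissible.neg_left {k : ℕ} {l m : ℤ} (h : Admissible k l m) : Admissible k (-l) m :=
  admissible_of_degree_eq (by simpa using h.degree_eq)

theorem Admissible.neg_right {k : ℕ} {l m : ℤ} (h : Admissible k l m) : Admissible k l (-m) :=
  admissible_of_degree_eq (by simpa using h.degree_eq)

theorem Admissible.abs_left {k : ℕ} {l m : ℤ} (h : Admissible k l m) : Admissible k |l| m :=
  admissible_of_degree_eq (l.natAbs_abs.symm ▸ h.degree_eq)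

theorem Admissible.abs_right {k : ℕ} {l m : ℤ} (h : Admissible k l m) : Admissible k l |m| :=
  admissible_of_degree_eq (m.natAbs_abs.symm ▸ h.degree_eq)

namespace Mode

variable {p : ℕ} {q : ℤ} {k : ℕ}

/-- The weight in `θ` of the complex harmonic polynomial whose real or imaginary part is the
mode. -/
def lWeight : Mode p q k → ℤ
  | .zero _ => 0
  | .lMode l _ _ _ => |l|
  | .mMode _ _ _ _ => 0
  | .e1 l _ _ _ _ _ => l
  | .e2 l _ _ _ _ _ => l
  | .e3 l _ _ _ _ _ => l
  | .e4 l _ _ _ _ _ => l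

/-- The weight in `φ` of the complex harmonic polynomial whose real or imaginary part is the
mode. -/
def mWeight : Mode p q k → ℤ
  | .zero _ => 0
  | .lMode _ _ _ _ => 0
  | .mMode m _ _ _ => |m|
  | .e1 _ m _ _ _ _ => -m
  | .e2 _ m _ _ _ _ => -m
  | .e3 _ m _ _ _ _ => m
  | .e4 _ m _ _ _ _ => m

/-- Whether the mode is an imaginary part of a complex harmonic polynomial. -/
def isIm : Mode p q k → Bool
  | .zero _ => false
  | .lMode l _ _ _ => decide (l < 0)
  | .mMode m _ _ _ => decide (m < 0)
  | .e1 _ _ _ _ _ _ => false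
  | .e2 _ _ _ _ _ _ => true
  | .e3 _ _ _ _ _ _ => false
  | .e4 _ _ _ _ _ _ => true

theorem isHalf (i : Mode p q k) : IsHalf i.isIm i.lWeight i.mWeight := by
  unfold IsHalf
  cases i <;> simp only [lWeight, mWeight, isIm] <;> grind

theorem admissible (i : Mode p q k) : Admissible k i.lWeight i.mWeight := by
  cases i with
  | zero h => exact h
  | lMode l hl h hc => exact h.abs_left
  | mMode m hm h hc => exact h.abs_right
  | e1 l m hl hm h hc => exact h.neg_right
  | e2 l m hl hm h hc => exact h.neg_right
  | e3 l m hl hm h hc => exact h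
  | e4 l m hl hm h hc => exact h

theorem dvd_weight (i : Mode p q k) : (p : ℤ) ∣ i.lWeight + q * i.mWeight := by
  cases i with
  | zero h => simp [lWeight, mWeight]
  | lMode l hl h hc => simpa [lWeight, mWeight] using hc.dvd
  | mMode m hm h hc =>
    have := Int.modEq_zero_iff_dvd.1 hc
    rcases abs_choice m with h' | h' <;> simpa [lWeight, mWeight, h'] using this
  | e1 l m hl hm h hc | e2 l m hl hm h hc | e3 l m hl hm h hc | e4 l m hl hm h hc =>
    simpa [lWeight, mWeight, sub_eq_add_neg] using hc.symm.dvd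

theorem weight_injective {i j : Mode p q k} (h1 : i.isIm = j.isIm) (h2 : i.lWeight = j.lWeight)
    (h3 : i.mWeight = j.mWeight) : i = j := by
  cases i <;> cases j <;> simp only [lWeight, mWeight, isIm] at h1 h2 h3 <;> grind

instance : Finite (Mode p q k) := by
  have hb (i : Mode p q k) :
      i.lWeight ∈ Set.Icc (-(k : ℤ)) k ∧ i.mWeight ∈ Set.Icc (-(k : ℤ)) k := by
    have := i.admissible.degree_eq
    simp only [Set.mem_Icc]
    omega
  refine Finite.of_injective (β := Bool × Set.Icc (-(k : ℤ)) k × Set.Icc (-(k : ℤ)) k)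
    (fun i => (i.isIm, ⟨i.lWeight, (hb i).1⟩, ⟨i.mWeight, (hb i).2⟩)) fun i j h => ?_
  simp only [Prod.mk.injEq, Subtype.mk.injEq] at h
  exact weight_injective h.1 h.2.1 h.2.2

theorem exists_of_weight {s : Bool} {l m : ℤ} (h : Admissible k l m) (hs : IsHalf s l m)
    (hd : (p : ℤ) ∣ l + q * m) :
    ∃ i : Mode p q k, i.isIm = s ∧ i.lWeight = l ∧ i.mWeight = m := by
  rcases hs with hl | ⟨rfl, hm | ⟨rfl, rfl⟩⟩
  · rcases lt_trichotomy m 0 with hm | rfl | hm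
    · have hc : l ≡ q * -m [ZMOD p] := (Int.modEq_iff_dvd.2 (by simpa using hd)).symm
      cases s
      · exact ⟨.e1 l (-m) hl (by omega) h.neg_right hc, by simp [isIm, lWeight, mWeight]⟩
      · exact ⟨.e2 l (-m) hl (by omega) h.neg_right hc, by simp [isIm, lWeight, mWeight]⟩
    · have hc : l ≡ 0 [ZMOD p] := Int.modEq_zero_iff_dvd.2 (by simpa using hd)
      cases s
      · exact ⟨.lMode l hl.ne' h hc, by simp [isIm, lWeight, mWeight, abs_of_pos hl, hl.le]⟩
      · exact ⟨.lMode (-l) (by omega) h.neg_left (by simpa using hc.neg),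
          by simp [isIm, lWeight, mWeight, abs_of_pos hl, hl]⟩
    · have hc : l ≡ -(q * m) [ZMOD p] := (Int.modEq_iff_dvd.2 (by simpa using hd)).symm
      cases s
      · exact ⟨.e3 l m hl hm h hc, by simp [isIm, lWeight, mWeight]⟩
      · exact ⟨.e4 l m hl hm h hc, by simp [isIm, lWeight, mWeight]⟩
  · have hc : q * m ≡ 0 [ZMOD p] := Int.modEq_zero_iff_dvd.2 (by simpa using hd)
    cases s
    · exact ⟨.mMode m hm.ne' h hc, by simp [isIm, lWeight, mWeight, abs_of_pos hm, hm.le]⟩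
    · exact ⟨.mMode (-m) (by omega) h.neg_right (by simpa using hc.neg),
        by simp [isIm, lWeight, mWeight, abs_of_pos hm, hm]⟩
  · exact ⟨.zero h, by simp [isIm, lWeight, mWeight]⟩

/-- The mode as a function on the whole 3-sphere, with no reference to coordinates. -/
def sphereFun (i : Mode p q k) : S3 → ℝ := realHarm i.isIm k i.lWeight i.mWeight

theorem sphereFun_toroidal (i : Mode p q k) (χ θ φ : ℝ) :
    i.sphereFun (toroidal χ θ φ) = i.toFun χ θ φ := by
  rw [sphereFun, realHarm_toroidal]
  cases i with
  | zero h => simp [isIm, lWeight, mWeight, toFun, psi_eq, circ_zero]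
  | lMode l hl h hc =>
    simp [isIm, lWeight, mWeight, toFun, psi_eq, psiRadial_abs_left, circ_zero, circ_eq l]
  | mMode m hm h hc =>
    simp [isIm, lWeight, mWeight, toFun, psi_eq, psiRadial_abs_right, circ_zero, circ_eq m]
  | e1 l m hl hm h hc | e2 l m hl hm h hc | e3 l m hl hm h hc | e4 l m hl hm h hc =>
    simp only [isIm, lWeight, mWeight, toFun, psi_eq, psiRadial_neg_left, psiRadial_neg_right,
      circ_of_pos hl, circ_of_pos hm, circ_neg_of_pos hl, circ_neg_of_pos hm, hl.ne', hm.ne',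
      neg_eq_zero, or_self, if_false, cond_true, cond_false, Int.cast_neg, neg_mul, Real.cos_add,
      Real.sin_add, Real.cos_neg, Real.sin_neg]
    ring

theorem isSmooth3_sphereFun (i : Mode p q k) : IsSmooth3 i.sphereFun := isSmooth3_realHarm _ _ _ _

theorem sphereLaplacian_sphereFun (i : Mode p q k) (x : S3) :
    sphereLaplacian i.sphereFun x = -((k : ℝ) * (k + 2)) * i.sphereFun x :=
  sphereLaplacian_realHarm _ i.admissible x

theorem integral_sphereFun_sq (i : Mode p q k) : ∫ x, i.sphereFun x * i.sphereFun x ∂vol3 = 1 :=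
  integral_realHarm_sq i.admissible i.isHalf

theorem integral_sphereFun_mul {i j : Mode p q k} (h : i ≠ j) :
    ∫ x, i.sphereFun x * j.sphereFun x ∂vol3 = 0 :=
  integral_realHarm_eq_zero k i.isHalf j.isHalf fun ⟨h1, h2, h3⟩ => h (weight_injective h1 h2 h3)

end Mode

/-! ### Modes on the lens space -/

theorem exp_weight_eq_one_iff {p : ℕ} (hp : 0 < p) (q l m : ℤ) :
    Complex.exp ((l * (2 * Real.pi / p) + m * (2 * Real.pi * q / p) : ℝ) * Complex.I) = 1 ↔
      (p : ℤ) ∣ l + q * m := by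
  have hp' : (p : ℂ) ≠ 0 := mod_cast hp.ne'
  have hangle : ((l * (2 * Real.pi / p) + m * (2 * Real.pi * q / p) : ℝ) : ℂ) * Complex.I =
      ((l + q * m : ℤ) : ℂ) / p * (2 * Real.pi * Complex.I) := by
    push_cast
    field_simp
  rw [hangle, Complex.exp_eq_one_iff]
  refine exists_congr fun n => ?_
  rw [mul_left_inj' Complex.two_pi_I_ne_zero, div_eq_iff hp', mul_comm (n : ℂ)]
  norm_cast

theorem harm_gen (p : ℕ) (q : ℤ) (d : ℕ) (l m : ℤ) (x : S3) : harm d l m (gen p q x) =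
    Complex.exp ((l * (2 * Real.pi / p) + m * (2 * Real.pi * q / p) : ℝ) * Complex.I) *
      harm d l m x :=
  harm_rot d l m _ _ x

theorem eq_of_orbitRel_zpowers {G X A : Type*} [Group G] [MulAction G X] {g : G} {F : X → A}
    (hF : ∀ x, F (g • x) = F x) (x y : X)
    (h : MulAction.orbitRel (Subgroup.zpowers g) X x y) : F x = F y := by
  obtain ⟨⟨_, n, rfl⟩, rfl⟩ := h
  suffices H : ∀ y, F (g ^ n • y) = F y from H y
  refine zpow_induction_left (P := fun s => ∀ y, F (s • y) = F y) (fun y => by rw [one_smul])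
    (fun s hs y => ?_) (fun s hs y => ?_) n
  · rw [mul_smul, hF, hs]
  · rw [mul_smul, ← hF, smul_inv_smul, hs]

variable {p : ℕ} {q : ℤ} {k : ℕ}

theorem Mode.sphereFun_gen (hp : 0 < p) (i : Mode p q k) (x : S3) :
    i.sphereFun (gen p q x) = i.sphereFun x := by
  rw [sphereFun, realHarm, realHarm, harm_gen, (exp_weight_eq_one_iff hp _ _ _).2 i.dvd_weight,
    one_mul]

/-- The mode as a function on the lens space. -/
def Mode.lensFun (hp : 0 < p) (i : Mode p q k) : Lens p q → ℝ :=
  Quotient.lift i.sphereFun (eq_of_orbitRel_zpowers (i.sphereFun_gen hp))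

theorem Mode.lensFun_mem (hp : 0 < p) (i : Mode p q k) :
    i.lensFun hp ∈ eigenspace p q (-((k : ℝ) * (k + 2))) := by
  refine ⟨i.isSmooth3_sphereFun, ?_⟩
  rintro ⟨x⟩
  exact i.sphereLaplacian_sphereFun x

/-! ### Completeness of the modes -/

theorem integral_lift_mul_harm_eq_zero (hp : 0 < p) (f : Lens p q → ℝ) (d : ℕ) {l m : ℤ}
    (h : ¬(p : ℤ) ∣ l + q * m) : ∫ x : S3, (lift f x : ℂ) * harm d l m x ∂vol3 = 0 := by
  refine integral_eq_zero_of_comp_spherePerm (rot (2 * Real.pi / p) (2 * Real.pi * q / p))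
    (mt (exp_weight_eq_one_iff hp q l m).1 h) fun x => ?_
  change (lift f (gen p q x) : ℂ) * harm d l m (gen p q x) = _
  rw [lift_gen, harm_gen, mul_left_comm]

theorem eq_zero_of_mem_eigenspace (hp : 0 < p) {c : ℝ} {f : Lens p q → ℝ}
    (hf : f ∈ eigenspace p q c)
    (h : ∀ (d : ℕ) (l m : ℤ) (k : ℕ), k = l.natAbs + m.natAbs + 2 * d → c = -((k : ℝ) * (k + 2)) →
      (p : ℤ) ∣ l + q * m → ∫ x : S3, (lift f x : ℂ) * harm d l m x ∂vol3 = 0) : f = 0 := by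
  have hlift : lift f = 0 := by
    refine eq_zero_of_integral_mul_harm_eq_zero hf.1.continuous fun d l m => ?_
    by_cases hd : (p : ℤ) ∣ l + q * m
    · by_contra hne
      have hc := not_imp_comm.1
        (integral_mul_harm_eq_zero hf.1 (fun x => hf.2 (proj p q x)) d l m rfl) hne
      exact hne (h d l m _ rfl hc hd)
    · exact integral_lift_mul_harm_eq_zero hp f d hd
  exact funext fun x => x.inductionOn (congrFun hlift)

theorem exists_eigenvalue_eq (hp : 0 < p) {c : ℝ} (hc : eigenspace p q c ≠ ⊥) :
    ∃ k : ℕ, c = -((k : ℝ) * (k + 2)) := by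
  by_contra hk
  refine hc ((Submodule.eq_bot_iff _).2 fun f hf => ?_)
  exact eq_zero_of_mem_eigenspace hp hf fun _ _ _ k _ h => absurd ⟨k, h⟩ hk

theorem integral_mul_re_phase_harm_neg (F : S3 → ℝ) (s : Bool) (d : ℕ) (l m : ℤ) :
    ∫ x : S3, F x * (phase s * harm d (-l) (-m) x).re ∂vol3 =
      cond s (-1) 1 * ∫ x : S3, F x * (phase s * harm d l m x).re ∂vol3 := by
  rw [← integral_const_mul]
  cases s <;> simp [phase, harm_neg]

theorem integral_mul_re_phase_harm_of_isHalf {F : S3 → ℝ}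
    (h : ∀ i : Mode p q k, ∫ x, F x * i.sphereFun x ∂vol3 = 0) {d : ℕ} {l m : ℤ}
    (hk : k = l.natAbs + m.natAbs + 2 * d) (hd : (p : ℤ) ∣ l + q * m) {s : Bool}
    (hs : IsHalf s l m) : ∫ x : S3, F x * (phase s * harm d l m x).re ∂vol3 = 0 := by
  obtain ⟨i, rfl, rfl, rfl⟩ := Mode.exists_of_weight (admissible_of_degree_eq hk) hs hd
  have hdeg : deg k i.lWeight i.mWeight = d := by
    have := i.admissible.degree_eq
    omega
  have hi := h i
  simp only [Mode.sphereFun, realHarm, hdeg, mul_left_comm (F _), integral_const_mul] at hi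
  exact (mul_eq_zero.1 hi).resolve_left (normFactor_pos _ _ _).ne'

theorem integral_mul_harm_eq_zero_of_modes {F : S3 → ℝ} (hF : Continuous F)
    (h : ∀ i : Mode p q k, ∫ x, F x * i.sphereFun x ∂vol3 = 0) {d : ℕ} {l m : ℤ}
    (hk : k = l.natAbs + m.natAbs + 2 * d) (hd : (p : ℤ) ∣ l + q * m) :
    ∫ x : S3, (F x : ℂ) * harm d l m x ∂vol3 = 0 := by
  refine eq_zero_of_re_phase_mul_eq_zero fun s => ?_
  have hre : (phase s * ∫ x : S3, (F x : ℂ) * harm d l m x ∂vol3).re =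
      ∫ x : S3, F x * (phase s * harm d l m x).re ∂vol3 := by
    have hc : Continuous fun x : S3 => phase s * ((F x : ℂ) * harm d l m x) :=
      ((Complex.continuous_ofReal.comp hF).mul (continuous_harm d l m)).const_mul _
    rw [← integral_const_mul]
    refine (Complex.reCLM.integral_comp_comm (integrable_of_continuous hc)).symm.trans ?_
    simp only [Complex.reCLM_apply, mul_left_comm (phase s), Complex.re_ofReal_mul]
  have hneg := integral_mul_re_phase_harm_neg F s d l m
  have hcases : IsHalf s l m ∨ IsHalf s (-l) (-m) ∨ s = true ∧ l = 0 ∧ m = 0 := by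
    unfold IsHalf
    grind
  rw [hre]
  rcases hcases with hs | hs | ⟨rfl, rfl, rfl⟩
  · exact integral_mul_re_phase_harm_of_isHalf h hk hd hs
  · rw [integral_mul_re_phase_harm_of_isHalf h (by simpa using hk)
      (by rwa [mul_neg, ← neg_add, dvd_neg]) hs] at hneg
    cases s <;> simpa using hneg.symm
  · rw [neg_zero, cond_true] at hneg
    linear_combination hneg / 2

/-! ### The eigenbasis -/

theorem span_range_eq_top_of_iIsOrtho {K E ι : Type*} [Field K] [AddCommGroup E] [Module K E]
    [Finite ι] {B : LinearMap.BilinForm K E} {v : ι → E} (hv : B.iIsOrtho v)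
    (hself : ∀ i, B (v i) (v i) ≠ 0) (hzero : ∀ x, (∀ i, B x (v i) = 0) → x = 0) :
    Submodule.span K (Set.range v) = ⊤ := by
  have := Fintype.ofFinite ι
  refine eq_top_iff.2 fun x _ => ?_
  have hx : x = ∑ i, (B x (v i) / B (v i) (v i)) • v i := by
    refine sub_eq_zero.1 (hzero _ fun j => ?_)
    rw [map_sub, map_sum, LinearMap.sub_apply, LinearMap.sum_apply, Finset.sum_eq_single j]
    · simp [div_mul_cancel₀ _ (hself j)]
    · intro i _ hij
      simp [LinearMap.BilinForm.iIsOrtho_def.1 hv i j hij]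
    · simp
  rw [hx]
  exact Submodule.sum_mem _ fun i _ => Submodule.smul_mem _ _ (Submodule.subset_span ⟨i, rfl⟩)

/-- `lensInner` as a bilinear form on an eigenspace, where all integrals converge. -/
def lensForm (p : ℕ) (q : ℤ) (c : ℝ) : LinearMap.BilinForm ℝ (eigenspace p q c) :=
  have hi (f g : eigenspace p q c) : Integrable (fun x =>
      lift (f : Lens p q → ℝ) x * lift (g : Lens p q → ℝ) x) vol3 :=
    integrable_of_continuous (f.2.1.continuous.mul g.2.1.continuous)
  LinearMap.mk₂ ℝ (fun f g => lensInner (f : Lens p q → ℝ) g)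
    (fun f f' g => by
      rw [lensInner, lensInner, lensInner, ← integral_add (hi f g) (hi f' g)]
      simp only [lift, Submodule.coe_add, Pi.add_apply, add_mul])
    (fun r f g => by
      rw [lensInner, lensInner, smul_eq_mul, ← integral_const_mul]
      simp only [lift, Submodule.coe_smul, Pi.smul_apply, smul_eq_mul, mul_assoc])
    (fun f g g' => by
      rw [lensInner, lensInner, lensInner, ← integral_add (hi f g) (hi f g')]
      simp only [lift, Submodule.coe_add, Pi.add_apply, mul_add])
    (fun r f g => by
      rw [lensInner, lensInner, smul_eq_mul, ← integral_const_mul]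
      simp only [lift, Submodule.coe_smul, Pi.smul_apply, smul_eq_mul, mul_left_comm])

/-- The mode as an element of its eigenspace. -/
def Mode.eigenvector (hp : 0 < p) (i : Mode p q k) : eigenspace p q (-((k : ℝ) * (k + 2))) :=
  ⟨i.lensFun hp, i.lensFun_mem hp⟩

theorem iIsOrtho_eigenvector (hp : 0 < p) :
    (lensForm p q (-((k : ℝ) * (k + 2)))).iIsOrtho (Mode.eigenvector hp) :=
  LinearMap.BilinForm.iIsOrtho_def.2 fun _ _ hij => Mode.integral_sphereFun_mul hij

theorem lensForm_eigenvector_self_ne_zero (hp : 0 < p) (i : Mode p q k) :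
    lensForm p q (-((k : ℝ) * (k + 2))) (i.eigenvector hp) (i.eigenvector hp) ≠ 0 :=
  i.integral_sphereFun_sq.trans_ne one_ne_zero

theorem span_eigenvector (hp : 0 < p) :
    Submodule.span ℝ (Set.range (Mode.eigenvector (q := q) (k := k) hp)) = ⊤ := by
  refine span_range_eq_top_of_iIsOrtho (iIsOrtho_eigenvector hp)
    (lensForm_eigenvector_self_ne_zero hp) fun f hf => Subtype.ext ?_
  refine eq_zero_of_mem_eigenspace hp f.2 fun d l m k' hk' hc hd => ?_
  obtain rfl := eigenvalue_injective hc
  exact integral_mul_harm_eq_zero_of_modes f.2.1.continuous hf hk' hd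

/-- The orthonormal eigenbasis formed by the modes. -/
def eigenbasis (hp : 0 < p) (q : ℤ) (k : ℕ) :
    Module.Basis (Mode p q k) ℝ (eigenspace p q (-((k : ℝ) * (k + 2)))) :=
  .mk (LinearMap.BilinForm.linearIndependent_of_iIsOrtho (iIsOrtho_eigenvector hp)
    (lensForm_eigenvector_self_ne_zero hp)) (span_eigenvector hp).ge

theorem lift_eigenbasis (hp : 0 < p) (i : Mode p q k) :
    lift (eigenbasis hp q k i : Lens p q → ℝ) = i.sphereFun := by
  rw [eigenbasis, Module.Basis.mk_apply]
  rfl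

theorem lensInner_eigenbasis_self (hp : 0 < p) (i : Mode p q k) :
    lensInner (eigenbasis hp q k i : Lens p q → ℝ) (eigenbasis hp q k i) = 1 := by
  rw [lensInner, lift_eigenbasis, i.integral_sphereFun_sq]

theorem lensInner_eigenbasis_of_ne (hp : 0 < p) {i j : Mode p q k} (hij : i ≠ j) :
    lensInner (eigenbasis hp q k i : Lens p q → ℝ) (eigenbasis hp q k j) = 0 := by
  rw [lensInner, lift_eigenbasis, lift_eigenbasis, Mode.integral_sphereFun_mul hij]

end LensSpace

end

theorem theorem2 (p : ℕ) (hp : 0 < p) (q : ℤ) :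
    (∀ c : ℝ, LensSpace.eigenspace p q c ≠ ⊥ → ∃ k : ℕ, c = -((k : ℝ) * (k + 2))) ∧
    ∀ k : ℕ, ∃ b : Module.Basis (LensSpace.Mode p q k) ℝ
        (LensSpace.eigenspace p q (-((k : ℝ) * (k + 2)))),
      (∀ i, LensSpace.lensInner (b i : LensSpace.Lens p q → ℝ) (b i) = 1) ∧
      (∀ i j, i ≠ j → LensSpace.lensInner (b i : LensSpace.Lens p q → ℝ) (b j) = 0) ∧
      (∀ i, ∀ χ ∈ Set.Icc (0 : ℝ) (Real.pi / 2), ∀ θ φ : ℝ,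
        LensSpace.lift (b i : LensSpace.Lens p q → ℝ) (LensSpace.toroidal χ θ φ) =
          i.toFun χ θ φ) := by
  refine ⟨fun c hc => LensSpace.exists_eigenvalue_eq hp hc, fun k =>
    ⟨LensSpace.eigenbasis hp q k, LensSpace.lensInner_eigenbasis_self hp,
      fun i j hij => LensSpace.lensInner_eigenbasis_of_ne hp hij, fun i χ _ θ φ => ?_⟩⟩
  rw [LensSpace.lift_eigenbasis, i.sphereFun_toroidal]
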